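/- Let $n\in\mathbb{N}$, $\sigma\ge 1$, $\delta\in(0,\sigma/2)$ with $n>2\delta$, let $u_1\in L^1(\mathbb{R}^n)$ be real-valued with $\int_{\mathbb{R}^n}u_1(x)\,dx>0$, and let $$1<p<1+\frac{4\delta}{n-2\delta}.$$ Then the Cauchy problem $$u_{tt}+(-\Delta)^{\sigma}u+(-\Delta)^{2\delta}u+2(-\Delta)^{\delta}u_t=|u|^p\quad (t>0,\ x\in\mathbb{R}^n),\qquad u(0,x)=0,\quad u_t(0,x)=u_1(x),$$ has no global (in time) weak solution. Here $(-\Delta)^\rho$, $\rho>0$, is the Fourier multiplier (in $x$) with symbol $|\xi|^{2\rho}$ (for $\hat f(\xi)=\int_{\mathbb{R}^n} e^{-ix\cdot\xi}f(x)\,dx$), and a global weak solution is a real-valued function $u\in L^p_{\mathrm{loc}}([0,\infty)\times\mathbb{R}^n)$ such that, for every real-valued $\psi\in C_c^\infty([0,\infty)\times\mathbb{R}^n)$, the functions $u\,(-\Delta)^\sigma\psi$, $u\,(-\Delta)^{2\delta}\psi$ and $u\,(-\Delta)^\delta\psi_t$ are integrable over $[0,\infty)\times\mathbb{R}^n$ and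 $$\int_0^\infty\!\!\int_{\mathbb{R}^n}|u|^p\psi\,dx\,dt=\int_0^\infty\!\!\int_{\mathbb{R}^n}u\,\psi_{tt}\,dx\,dt+\int_0^\infty\!\!\int_{\mathbb{R}^n}u\,(-\Delta)^\sigma\psi\,dx\,dt+\int_0^\infty\!\!\int_{\mathbb{R}^n}u\,(-\Delta)^{2\delta}\psi\,dx\,dt-2\int_0^\infty\!\!\int_{\mathbb{R}^n}u\,(-\Delta)^{\delta}\psi_t\,dx\,dt-\int_{\mathbb{R}^n}u_1(x)\,\psi(0,x)\,dx.$$ -/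

import Mathlib

open MeasureTheory Set
open scoped FourierTransform ContDiff

noncomputable section

/-- The fractional Laplacian `(-Δ)^ρ` on `ℝⁿ`, as the Fourier multiplier with symbol `|ξ|^(2ρ)`
in the convention `∫ exp (-i x·ξ) f(x) dx`. Mathlib's Fourier transform uses
`exp (-2πi x·ξ)`, so the symbol becomes `(2π|ξ|)^(2ρ)`. As the symbol is real and even,
the inverse transform is already real for a real test function `f`; `.re` only
changes the type. -/
def fracLaplacian {n : ℕ} (ρ : ℝ) (f : EuclideanSpace ℝ (Fin n) → ℝ) :
    EuclideanSpace ℝ (Fin n) → ℝ :=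
  fun x => (𝓕⁻ (fun ξ : EuclideanSpace ℝ (Fin n) =>
    (((2 * Real.pi * ‖ξ‖) ^ (2 * ρ) : ℝ) : ℂ) *
      𝓕 (fun y : EuclideanSpace ℝ (Fin n) => (f y : ℂ)) ξ) x).re

/-- The time derivative `ψ_t(t, x)` of a function of `(t, x)`. -/
def timeDeriv {n : ℕ} (ψ : ℝ × EuclideanSpace ℝ (Fin n) → ℝ) :
    ℝ × EuclideanSpace ℝ (Fin n) → ℝ :=
  fun z => deriv (fun t => ψ (t, z.2)) z.1

/-- `(-Δ)^ρ` acting on the space variable of a function of `(t, x)`. -/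
def spaceFracLaplacian {n : ℕ} (ρ : ℝ) (ψ : ℝ × EuclideanSpace ℝ (Fin n) → ℝ) :
    ℝ × EuclideanSpace ℝ (Fin n) → ℝ :=
  fun z => fracLaplacian ρ (fun x => ψ (z.1, x)) z.2

/-- The space-time domain `[0, ∞) × ℝⁿ`. -/
def spaceTime (n : ℕ) : Set (ℝ × EuclideanSpace ℝ (Fin n)) :=
  Ici (0 : ℝ) ×ˢ univ

/-- Representatives of test functions in `C_c^∞([0, ∞) × ℝⁿ)`: these are the restrictions to
`[0, ∞) × ℝⁿ` (so not required to vanish at `t = 0`) of functions in `C_c^∞(ℝ × ℝⁿ)`. -/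
def IsTestFunction {n : ℕ} (ψ : ℝ × EuclideanSpace ℝ (Fin n) → ℝ) : Prop :=
  ContDiff ℝ ∞ ψ ∧ HasCompactSupport ψ

/-- `u ∈ L^p_loc([0, ∞) × ℝⁿ)`; values of `u` at negative times play no role. -/
def MemLpLoc {n : ℕ} (p : ℝ) (u : ℝ × EuclideanSpace ℝ (Fin n) → ℝ) : Prop :=
  ∀ K : Set (ℝ × EuclideanSpace ℝ (Fin n)), IsCompact K → K ⊆ spaceTime n →
    MemLp u (ENNReal.ofReal p) (volume.restrict K)

/-- Global (in time) weak solutions of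
`u_tt + (-Δ)^σ u + (-Δ)^(2δ) u + 2 (-Δ)^δ u_t = |u|^p`, `u(0, x) = 0`, `u_t(0, x) = u₁(x)`.
Since `(-Δ)^ρ ψ` need not have compact support, membership of `u` in `L^p_loc` does not make the
three integrals with a fractional Laplacian converge; as the weak identity only makes sense when
they do, their absolute convergence is part of the definition. The integrals of `|u|^p ψ` and of
`u ψ_tt` converge because `u ∈ L^p_loc`. -/
structure IsGlobalWeakSolution {n : ℕ} (σ δ p : ℝ) (u₁ : EuclideanSpace ℝ (Fin n) → ℝ)
    (u : ℝ × EuclideanSpace ℝ (Fin n) → ℝ) : Prop where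
  memLpLoc : MemLpLoc p u
  integrable_sigma : ∀ ψ : ℝ × EuclideanSpace ℝ (Fin n) → ℝ, IsTestFunction ψ →
    IntegrableOn (fun z => spaceFracLaplacian σ ψ z * u z) (spaceTime n)
  integrable_two_delta : ∀ ψ : ℝ × EuclideanSpace ℝ (Fin n) → ℝ, IsTestFunction ψ →
    IntegrableOn (fun z => spaceFracLaplacian (2 * δ) ψ z * u z) (spaceTime n)
  integrable_delta : ∀ ψ : ℝ × EuclideanSpace ℝ (Fin n) → ℝ, IsTestFunction ψ →
    IntegrableOn (fun z => spaceFracLaplacian δ (timeDeriv ψ) z * u z) (spaceTime n)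
  weak_identity : ∀ ψ : ℝ × EuclideanSpace ℝ (Fin n) → ℝ, IsTestFunction ψ →
    ∫ z in spaceTime n, |u z| ^ p * ψ z =
      (∫ z in spaceTime n, u z * timeDeriv (timeDeriv ψ) z)
      + (∫ z in spaceTime n, spaceFracLaplacian σ ψ z * u z)
      + (∫ z in spaceTime n, spaceFracLaplacian (2 * δ) ψ z * u z)
      - 2 * (∫ z in spaceTime n, spaceFracLaplacian δ (timeDeriv ψ) z * u z)
      - ∫ x, u₁ x * ψ (0, x)

end

/-! The proof is a test function argument with `ψ(t,x) = η(a^(2δ) t) φ(a x)` and `a → 0`. Under this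
scaling `ψ_tt`, `(-Δ)^(2δ) ψ` and `(-Δ)^δ ψ_t` all carry the factor `a^(4δ)`, while `(-Δ)^σ ψ`
carries `a^(2σ) ≤ a^(4δ)`. If `φ` and its images under the three operators are bounded by `φ^(1/p)
h` with `h ∈ L^(p')`, `p' = p/(p-1)`, then Young's inequality absorbs the nonlinear term and leaves
`∫ u₁ φ(a·) ≤ const · a^(4δp' - 2δ - n)`. The exponent is positive exactly in the subcritical range,
so `a → 0` gives `∫ u₁ ≤ 0` (`IsGlobalWeakSolution.integral_mul_profile_le`,
`IsGlobalWeakSolution.integral_nonpos`).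

The difficulty is the choice of `φ`, because at noninteger order the fractional Laplacian of a bump
has a polynomial tail that no compactly supported `φ` can dominate. The profile is then `⟨x⟩^(-b)`.
Writing `(-Δ)^ρ` as an integral of symmetric differences of order `2m > 2ρ`
(`exists_fracLaplacian_eq_integral`) yields `|(-Δ)^ρ φ| ≲ φ` for `n < b ≤ n + 2ρ`, uniformly along
compactly supported truncations (`exists_abs_fracLaplacian_le`). At integer order the operator is
local and every `b` works (`abs_fracLaplacian_natCast_le`).

The argument also needs `u` to be integrable against `φ` on time slabs. This is extracted from the
integrability clauses of the definition: at noninteger order the tail of `(-Δ)^ρ` of a bump is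
bounded below by `⟨x⟩^(-n-2ρ)` (`exists_le_abs_fracLaplacian`). Its coefficient is nonzero because,
as a function of the order, it is an exponential sum with `m` frequencies that already vanishes at
`1, …, m-1` (`diffCoeff_ne_zero`). Hence `b = n + 2δ` if `δ` is not an integer and `b = n + 2σ` if
only `σ` is not; if both are integers, a compactly supported `φ` suffices. -/

noncomputable section

set_option linter.unusedSectionVars false

/-! ### Derivative bounds for polynomial weights and cutoffs. -/

section Calculus

variable {E : Type*} [NormedAddCommGroup E] [InnerProductSpace ℝ E]

/-- The polynomial weight `(1 + |x|²)^(-b/2)`. -/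
def bracketWeight (b : ℝ) (x : E) : ℝ := (1 + ‖x‖ ^ 2) ^ (-b / 2)

lemma bracketWeight_pos (b : ℝ) (x : E) : 0 < bracketWeight b x :=
  Real.rpow_pos_of_pos (by positivity) _

lemma bracketWeight_zero (b : ℝ) : bracketWeight b (0 : E) = 1 := by
  simp [bracketWeight]

lemma bracketWeight_le_one {b : ℝ} (hb : 0 ≤ b) (x : E) : bracketWeight b x ≤ 1 :=
  Real.rpow_le_one_of_one_le_of_nonpos (by nlinarith [sq_nonneg ‖x‖]) (by linarith)

lemma contDiff_bracketWeight (b : ℝ) : ContDiff ℝ ∞ (bracketWeight b : E → ℝ) := by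
  unfold bracketWeight
  exact (contDiff_const.add (contDiff_norm_sq ℝ)).rpow_const_of_ne (fun x => by positivity)

lemma continuous_bracketWeight (b : ℝ) : Continuous (bracketWeight b : E → ℝ) :=
  (contDiff_bracketWeight b).continuous

/-- Comparison of weights at two points with comparable brackets. -/
lemma bracketWeight_le_mul {b : ℝ} (hb : 0 ≤ b) {L : ℝ} (hL : 0 < L) {x y : E}
    (h : 1 + ‖y‖ ^ 2 ≤ L ^ 2 * (1 + ‖x‖ ^ 2)) :
    bracketWeight b x ≤ L ^ b * bracketWeight b y := by
  have h1 : (L ^ 2 * (1 + ‖x‖ ^ 2)) ^ (-b / 2) ≤ (1 + ‖y‖ ^ 2) ^ (-b / 2) :=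
    Real.rpow_le_rpow_of_nonpos (by positivity) h (by linarith)
  have h2 : (L ^ 2) ^ (-b / 2) = (L ^ b)⁻¹ := by
    rw [← Real.rpow_natCast, ← Real.rpow_mul hL.le, ← Real.rpow_neg hL.le]
    congr 1; push_cast; ring
  rw [Real.mul_rpow (by positivity) (by positivity), h2] at h1
  have h3 : 0 < L ^ b := Real.rpow_pos_of_pos hL _
  unfold bracketWeight
  rwa [inv_mul_le_iff₀ h3] at h1

/-- For `r ≥ 1`, `1 + (‖y‖ + r)² ≤ (2r)² (1 + ‖y‖²)`. Lets a derivative bound near `x` be expressed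
by the weight at `x` itself. -/
lemma bracketWeight_le_shift {b r : ℝ} (hb : 0 ≤ b) (hr : 1 ≤ r) {x y : E} (h : ‖y - x‖ ≤ r) :
    bracketWeight b y ≤ (2 * r) ^ b * bracketWeight b x := by
  apply bracketWeight_le_mul hb (by linarith)
  have h1 : ‖x‖ ≤ ‖y‖ + r := by
    have := norm_sub_norm_le x y
    rw [norm_sub_rev] at this
    linarith
  have h2 : ‖x‖ ^ 2 ≤ (‖y‖ + r) ^ 2 := by gcongr
  nlinarith [sq_nonneg (‖y‖ - r), sq_nonneg ‖y‖, mul_nonneg (sq_nonneg ‖y‖) (by nlinarith : 0 ≤ r ^ 2 - 1)]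

/-- Transfers integrability of `u` against the weight to the dilated weights used in the scaling
argument. -/
lemma bracketWeight_comp_smul_le {b R : ℝ} (hb : 0 ≤ b) (hR : 1 ≤ R) (x : E) :
    bracketWeight b (R⁻¹ • x) ≤ R ^ b * bracketWeight b x := by
  have hR0 : 0 < R := by linarith
  apply bracketWeight_le_mul hb hR0
  rw [norm_smul, Real.norm_eq_abs, abs_of_pos (inv_pos.2 hR0), mul_pow, mul_add, ← mul_assoc,
    ← mul_pow, mul_inv_cancel₀ hR0.ne']
  nlinarith

/-- The product of two translated weights is controlled by the weight of the distance. -/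
lemma bracketWeight_mul_le {b : ℝ} (hb : 0 ≤ b) (x z : E) :
    bracketWeight b (x + z) * bracketWeight b z ≤
      2 ^ b * bracketWeight b x * (bracketWeight b (x + z) + bracketWeight b z) := by
  have hx : ‖x‖ ≤ ‖x + z‖ + ‖z‖ := by
    simpa using norm_sub_le (x + z) z
  have p1 := bracketWeight_pos b (x + z)
  have p2 := bracketWeight_pos b z
  have p3 := bracketWeight_pos b x
  have p4 : (0 : ℝ) < 2 ^ b := by positivity
  -- The larger of `‖x + z‖` and `‖z‖` is at least `‖x‖ / 2`, so the weight there is at most `2 ^ b`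
  -- times the weight at `x`; the other factor is kept.
  rcases le_total ‖z‖ ‖x + z‖ with h | h
  · have h1 : bracketWeight b (x + z) ≤ 2 ^ b * bracketWeight b x := by
      apply bracketWeight_le_mul hb two_pos
      have : ‖x‖ ^ 2 ≤ (2 * ‖x + z‖) ^ 2 := by gcongr; linarith
      nlinarith
    have := mul_le_mul_of_nonneg_right h1 p2.le
    have := mul_pos (mul_pos p4 p3) p1
    linarith [mul_add (2 ^ b * bracketWeight b x) (bracketWeight b (x + z)) (bracketWeight b z)]
  · have h1 : bracketWeight b z ≤ 2 ^ b * bracketWeight b x := by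
      apply bracketWeight_le_mul hb two_pos
      have : ‖x‖ ^ 2 ≤ (2 * ‖z‖) ^ 2 := by gcongr; linarith
      nlinarith
    have := mul_le_mul_of_nonneg_left h1 p1.le
    have := mul_pos (mul_pos p4 p3) p2
    linarith [mul_add (2 ^ b * bracketWeight b x) (bracketWeight b (x + z)) (bracketWeight b z)]

/-- The quadratic is normalised to equal `1` at `x`. Its first two derivatives at `x` are then at
most `2`, and the higher ones vanish, which is the form of bound needed for the composition estimate
with `D = 2`. -/
lemma norm_iteratedFDeriv_one_add_norm_sq_div_le (x : E) (i : ℕ) (hi : 1 ≤ i) :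
    ‖iteratedFDeriv ℝ i (fun z : E => (1 + ‖x‖ ^ 2)⁻¹ * (1 + ‖z‖ ^ 2)) x‖ ≤ 2 ^ i := by
  set a := (1 + ‖x‖ ^ 2)⁻¹ with ha
  have hx0 : 0 < 1 + ‖x‖ ^ 2 := by positivity
  have ha0 : 0 < a := inv_pos.2 hx0
  have ha1 : a ≤ 1 := inv_le_one_of_one_le₀ (by nlinarith [sq_nonneg ‖x‖])
  have hfd : fderiv ℝ (fun z : E => a * (1 + ‖z‖ ^ 2)) = fun z => (2 * a) • innerSL ℝ z := by
    ext z v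
    have h : HasFDerivAt (fun z : E => a * (1 + ‖z‖ ^ 2)) (a • (2 • innerSL ℝ z)) z :=
      (((hasStrictFDerivAt_norm_sq z).hasFDerivAt).const_add 1).const_mul a
    rw [h.fderiv]
    simp
    ring
  obtain ⟨j, rfl⟩ : ∃ j, i = j + 1 := ⟨i - 1, by omega⟩
  rw [← norm_iteratedFDeriv_fderiv, hfd]
  rcases j with _ | j
  · rw [norm_iteratedFDeriv_zero, norm_smul, innerSL_apply_norm, Real.norm_eq_abs,
      abs_of_pos (by positivity)]
    have : a * ‖x‖ ≤ 1 := by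
      rw [ha, inv_mul_le_iff₀ hx0]
      nlinarith [sq_nonneg (‖x‖ - 1), sq_nonneg ‖x‖]
    norm_num; nlinarith
  · rw [← norm_iteratedFDeriv_fderiv]
    obtain ⟨L, hL⟩ : ∃ L : E →L[ℝ] E →L[ℝ] ℝ, ∀ z, L z = innerSL ℝ z :=
      ⟨innerSL ℝ, fun _ => rfl⟩
    have hL1 : ‖L‖ ≤ 1 := L.opNorm_le_bound zero_le_one fun z => by
      rw [hL, innerSL_apply_norm, one_mul]
    have hfd2 : fderiv ℝ (fun z : E => (2 * a) • innerSL ℝ z) = fun _ => (2 * a) • L := by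
      ext1 z
      simp_rw [← hL]
      exact ((2 * a) • L).fderiv
    rw [hfd2]
    rcases j with _ | j
    · rw [norm_iteratedFDeriv_zero, norm_smul, Real.norm_eq_abs, abs_of_pos (by positivity)]
      norm_num
      nlinarith [norm_nonneg L]
    · rw [iteratedFDeriv_const_of_ne (by omega)]
      simp

/-- All derivatives of the weight are controlled by the weight itself. -/
lemma exists_norm_iteratedFDeriv_bracketWeight_le (b : ℝ) (j : ℕ) :
    ∃ C, 0 ≤ C ∧ ∀ i ≤ j, ∀ x : E,
      ‖iteratedFDeriv ℝ i (bracketWeight b : E → ℝ) x‖ ≤ C * bracketWeight b x := by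
  set g : ℝ → ℝ := fun t => t ^ (-b / 2)
  set c : ℝ := ∑ i ∈ Finset.range (j + 1), ‖iteratedFDerivWithin ℝ i g (Ioi 0) 1‖
  have hc0 : 0 ≤ c := Finset.sum_nonneg fun _ _ => norm_nonneg _
  refine ⟨j.factorial * c * 2 ^ j, by positivity, fun i hi x => ?_⟩
  have hx0 : 0 < 1 + ‖x‖ ^ 2 := by positivity
  -- With `x` frozen, the weight is its value at `x` times `g ∘ f` with `f x = 1`; only derivatives
  -- of `g` at the single point `1` enter, so the constant does not depend on `x`.
  set f : E → ℝ := fun z : E => (1 + ‖x‖ ^ 2)⁻¹ * (1 + ‖z‖ ^ 2) with hf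
  have hfx : f x = 1 := by simp [hf, hx0.ne']
  have hw : (bracketWeight b : E → ℝ) = bracketWeight b x • (g ∘ f) := by
    ext z
    simp only [Pi.smul_apply, Function.comp_apply, smul_eq_mul, g, hf, bracketWeight]
    rw [← Real.mul_rpow hx0.le (by positivity), ← mul_assoc, mul_inv_cancel₀ hx0.ne', one_mul]
  have hfr : Set.range f ⊆ Ioi 0 := by
    rintro _ ⟨z, rfl⟩
    simp only [hf, mem_Ioi]; positivity
  have hfs : ContDiff ℝ ∞ f := contDiff_const.mul (contDiff_const.add (contDiff_norm_sq ℝ))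
  have hg : ContDiffOn ℝ ∞ g (Ioi 0) := fun t ht =>
    (Real.contDiffAt_rpow_const_of_ne (ne_of_gt ht)).contDiffWithinAt
  have hgf : ContDiff ℝ ∞ (g ∘ f) := by
    rw [← contDiffOn_univ]
    exact hg.comp hfs.contDiffOn (fun z _ => hfr ⟨z, rfl⟩)
  have key := norm_iteratedFDeriv_comp_le' (n := i) (C := c) (D := 2) hfr
    (isOpen_Ioi.uniqueDiffOn) hg hfs (by exact_mod_cast le_top) x
    (fun k hk => by
      rw [hfx]
      exact Finset.single_le_sum (f := fun i => ‖iteratedFDerivWithin ℝ i g (Ioi 0) 1‖)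
        (fun _ _ => norm_nonneg _) (Finset.mem_range.2 (by omega)))
    (fun k hk _ => norm_iteratedFDeriv_one_add_norm_sq_div_le x k hk)
  have hmono : (i.factorial : ℝ) * c * 2 ^ i ≤ j.factorial * c * 2 ^ j := by
    gcongr
    norm_num
  rw [hw, iteratedFDeriv_const_smul_apply (hgf.contDiffAt.of_le (by exact_mod_cast le_top)),
    norm_smul, Real.norm_eq_abs, abs_of_pos (bracketWeight_pos b x)]
  have hval : (bracketWeight b x • (g ∘ f)) x = bracketWeight b x := by rw [← hw]
  rw [hval, mul_comm]
  exact mul_le_mul_of_nonneg_right (key.trans hmono) (bracketWeight_pos b x).le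

lemma exists_norm_iteratedFDeriv_le_of_hasCompactSupport {χ : E → ℝ} (hχ : ContDiff ℝ ∞ χ)
    (hc : HasCompactSupport χ) (j : ℕ) :
    ∃ C, 0 ≤ C ∧ ∀ i ≤ j, ∀ x, ‖iteratedFDeriv ℝ i χ x‖ ≤ C := by
  have h : ∀ i : ℕ, ∃ C, ∀ x, ‖iteratedFDeriv ℝ i χ x‖ ≤ C := fun i =>
    (hc.iteratedFDeriv i).exists_bound_of_continuous
      (hχ.continuous_iteratedFDeriv (by exact_mod_cast le_top))
  choose C hC using h
  have hC0 : ∀ i, 0 ≤ C i := fun i => (norm_nonneg _).trans (hC i 0)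
  refine ⟨∑ i ∈ Finset.range (j + 1), C i, Finset.sum_nonneg fun i _ => hC0 i,
    fun i hi x => (hC i x).trans ?_⟩
  exact Finset.single_le_sum (f := C) (fun i _ => hC0 i) (Finset.mem_range.2 (by omega))

/-- High powers of a cutoff have derivatives controlled by slightly lower powers. -/
lemma exists_norm_iteratedFDeriv_pow_le {χ : E → ℝ} (hχ : ContDiff ℝ ∞ χ)
    (hc : HasCompactSupport χ) (h0 : ∀ x, 0 ≤ χ x) (h1 : ∀ x, χ x ≤ 1) (M j : ℕ) :
    ∃ C, 0 ≤ C ∧ ∀ i ≤ j, ∀ x,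
      ‖iteratedFDeriv ℝ i (fun y => χ y ^ M) x‖ ≤ C * χ x ^ (M - j) := by
  obtain ⟨D, hD0, hD⟩ := exists_norm_iteratedFDeriv_le_of_hasCompactSupport hχ hc j
  set c : ℝ := ∑ k ∈ Finset.range (j + 1), (M.descFactorial k : ℝ)
  have hc0 : 0 ≤ c := Finset.sum_nonneg fun _ _ => by positivity
  refine ⟨j.factorial * c * (1 + D) ^ j, by positivity, fun i hi x => ?_⟩
  have hx := h0 x
  -- The `k`-th derivative of `t ^ M` at `χ x` is a multiple of `χ x ^ (M - k)`, which is at most `χ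
  -- x ^ (M - j)` because `0 ≤ χ ≤ 1` and `k ≤ j`. Replacing `D` by `1 + D` makes it at most its own
  -- positive powers.
  have key := norm_iteratedFDeriv_comp_le (𝕜 := ℝ) (n := i) (N := ∞) (g := fun t : ℝ => t ^ M)
    (f := χ) (C := c * χ x ^ (M - j))
    (D := 1 + D) (contDiff_id.pow M) hχ (by exact_mod_cast le_top) x
    (fun k hk => by
      rw [norm_iteratedFDeriv_eq_norm_iteratedDeriv, iteratedDeriv_pow, norm_mul,
        Real.norm_eq_abs, Real.norm_eq_abs, abs_of_nonneg (by positivity),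
        abs_of_nonneg (by positivity)]
      refine mul_le_mul ?_ (pow_le_pow_of_le_one (h0 x) (h1 x) (by omega)) (by positivity) hc0
      exact Finset.single_le_sum (f := fun k => (M.descFactorial k : ℝ))
        (fun _ _ => by positivity) (Finset.mem_range.2 (by omega)))
    (fun k hk1 hk => (hD k (by omega) x).trans (by
      calc D ≤ (1 + D) ^ 1 := by linarith
        _ ≤ (1 + D) ^ k := pow_le_pow_right₀ (by linarith) hk1))
  calc _ ≤ (i.factorial : ℝ) * (c * χ x ^ (M - j)) * (1 + D) ^ i := key
    _ ≤ j.factorial * (c * χ x ^ (M - j)) * (1 + D) ^ j := by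
      gcongr
      linarith
    _ = _ := by ring

/-- Smooth truncations of the weight have derivatives controlled by the weight, uniformly in the
truncation radius. -/
lemma exists_norm_iteratedFDeriv_truncation_le {χ : E → ℝ} (hχ : ContDiff ℝ ∞ χ)
    (hc : HasCompactSupport χ) (b : ℝ) (j : ℕ) :
    ∃ C, 0 ≤ C ∧ ∀ (k : ℕ) (i : ℕ), i ≤ j → ∀ x : E,
      ‖iteratedFDeriv ℝ i (fun y => χ (((k : ℝ) + 1)⁻¹ • y) * bracketWeight b y) x‖ ≤
        C * bracketWeight b x := by
  obtain ⟨D, hD0, hD⟩ := exists_norm_iteratedFDeriv_le_of_hasCompactSupport hχ hc j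
  obtain ⟨C, hC0, hC⟩ := exists_norm_iteratedFDeriv_bracketWeight_le (E := E) b j
  refine ⟨∑ l ∈ Finset.range (j + 1), 2 ^ j * D * C, by positivity, fun k i hi x => ?_⟩
  -- Dilation by a factor at most `1` does not enlarge derivatives; hence the uniformity in `k`.
  have hcut : ∀ l ≤ j, ‖iteratedFDeriv ℝ l (fun y : E => χ (((k : ℝ) + 1)⁻¹ • y)) x‖ ≤ D := by
    intro l hl
    rw [iteratedFDeriv_comp_const_smul _ (hχ.of_le (by exact_mod_cast le_top)), norm_smul,
      norm_pow, Real.norm_eq_abs, abs_of_pos (by positivity)]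
    calc _ ≤ 1 * D := by
          gcongr
          · exact pow_le_one₀ (by positivity) (inv_le_one_of_one_le₀ (by linarith [k.cast_nonneg (α := ℝ)]))
          · exact hD l hl _
      _ = D := one_mul D
  have key := norm_iteratedFDeriv_mul_le (𝕜 := ℝ) (n := i) (N := ∞)
    (f := fun y : E => χ (((k : ℝ) + 1)⁻¹ • y)) (g := bracketWeight b)
    (hχ.comp (contDiff_const_smul _)) (contDiff_bracketWeight b) x (by exact_mod_cast le_top)
  refine key.trans ?_
  rw [Finset.sum_mul]
  have hw := (bracketWeight_pos b x).le
  calc _ ≤ ∑ l ∈ Finset.range (i + 1), 2 ^ j * D * C * bracketWeight b x := by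
        refine Finset.sum_le_sum fun l hl => ?_
        rw [Finset.mem_range] at hl
        have e1 : (i.choose l : ℝ) ≤ 2 ^ j := by
          have h2 : i.choose l ≤ 2 ^ j := (Nat.choose_le_two_pow i l).trans
            (Nat.pow_le_pow_right (by norm_num) hi)
          exact_mod_cast h2
        calc _ ≤ 2 ^ j * D * (C * bracketWeight b x) := by
              gcongr
              · exact hcut l (by omega)
              · exact hC _ (by omega) x
          _ = _ := by ring
    _ ≤ _ := Finset.sum_le_sum_of_subset_of_nonneg
      (Finset.range_subset_range.2 (by omega)) (fun _ _ _ => by positivity)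

end Calculus

/-! ### The Riesz-type kernel and the Fourier symbol of symmetric differences. -/

section Kernel

variable {E : Type*} [NormedAddCommGroup E] [InnerProductSpace ℝ E] [FiniteDimensional ℝ E]
  [MeasurableSpace E] [BorelSpace E]

/-- The Riesz-type kernel `|y|^(-(d + 2ρ))`, where `d` is the dimension. -/
def rieszKernel (ρ : ℝ) (y : E) : ℝ := ‖y‖ ^ (-((Module.finrank ℝ E : ℝ) + 2 * ρ))

lemma rieszKernel_nonneg (ρ : ℝ) (y : E) : 0 ≤ rieszKernel ρ y := by
  unfold rieszKernel; positivity

lemma measurable_rieszKernel (ρ : ℝ) : Measurable (rieszKernel ρ : E → ℝ) := by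
  unfold rieszKernel; fun_prop

lemma rieszKernel_smul {r : ℝ} (hr : 0 < r) (ρ : ℝ) (y : E) :
    rieszKernel ρ (r • y) = r ^ (-((Module.finrank ℝ E : ℝ) + 2 * ρ)) * rieszKernel ρ y := by
  unfold rieszKernel
  rw [norm_smul, Real.norm_eq_abs, abs_of_pos hr, Real.mul_rpow hr.le (norm_nonneg _)]

/-- In polar coordinates the integrand is `r^(2m-2ρ-1)` near zero, integrable since `ρ < m`, and
`r^(-1-2ρ)` at infinity, integrable since `0 < ρ`. -/
lemma integrable_min_mul_rieszKernel [Nontrivial E] {ρ : ℝ} (hρ : 0 < ρ) {m : ℕ} (hm : ρ < m) :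
    Integrable (fun y : E => min 1 (‖y‖ ^ (2 * m)) * rieszKernel ρ y) := by
  set d := Module.finrank ℝ E with hd
  have hd1 : 1 ≤ d := Module.finrank_pos
  have key : IntegrableOn (fun r : ℝ => r ^ (d - 1) •
      (min 1 (r ^ (2 * m)) * r ^ (-((d : ℝ) + 2 * ρ)))) (Ioi 0) := by
    rw [← Ioc_union_Ioi_eq_Ioi zero_le_one]
    refine IntegrableOn.union ?_ ?_
    · have h := (intervalIntegral.intervalIntegrable_rpow' (a := 0) (b := 1)
        (r := 2 * m - 2 * ρ - 1) (by linarith)).1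
      refine h.congr_fun (fun r hr => ?_) measurableSet_Ioc
      have h0 : 0 < r := hr.1
      simp only [smul_eq_mul]
      rw [min_eq_right (pow_le_one₀ h0.le hr.2), ← Real.rpow_natCast r (d - 1),
        ← Real.rpow_natCast r (2 * m), ← Real.rpow_add h0, ← Real.rpow_add h0]
      congr 1
      push_cast [Nat.cast_sub hd1]
      ring
    · have h := integrableOn_Ioi_rpow_of_lt (a := -1 - 2 * ρ) (c := 1) (by linarith) zero_lt_one
      refine h.congr_fun (fun r hr => ?_) measurableSet_Ioi
      have h1 : 1 < r := hr
      have h0 : 0 < r := by linarith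
      simp only [smul_eq_mul]
      rw [min_eq_left (one_le_pow₀ h1.le), ← Real.rpow_natCast r (d - 1), one_mul,
        ← Real.rpow_add h0]
      congr 1
      push_cast [Nat.cast_sub hd1]
      ring
  exact (integrable_fun_norm_addHaar (volume : Measure E)
    (f := fun r => min 1 (r ^ (2 * m)) * r ^ (-((d : ℝ) + 2 * ρ)))).2 key

/-- The symbol of the symmetric difference of order `2m` in direction `y`. -/
def diffSymbol (m : ℕ) (ξ y : E) : ℝ := (2 - 2 * Real.cos (2 * Real.pi * inner ℝ y ξ)) ^ m

lemma diffSymbol_nonneg (m : ℕ) (ξ y : E) : 0 ≤ diffSymbol m ξ y :=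
  pow_nonneg (by linarith [Real.cos_le_one (2 * Real.pi * inner ℝ y ξ)]) _

lemma continuous_diffSymbol (m : ℕ) : Continuous fun z : E × E => diffSymbol m z.1 z.2 := by
  unfold diffSymbol; fun_prop

/-- Both `2 - 2 cos θ ≤ 4` and `2 - 2 cos θ ≤ θ²` hold; the first serves large `y`, the second small
`y`. -/
lemma diffSymbol_le (m : ℕ) (ξ y : E) :
    diffSymbol m ξ y ≤ (4 ^ m + (2 * Real.pi * ‖ξ‖) ^ (2 * m)) * min 1 (‖y‖ ^ (2 * m)) := by
  set θ := 2 * Real.pi * inner ℝ y ξ with hθ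
  have h0 : 0 ≤ 2 - 2 * Real.cos θ := by linarith [Real.cos_le_one θ]
  have hπ : 0 ≤ 2 * Real.pi * ‖ξ‖ := by positivity
  rcases le_total 1 (‖y‖ ^ (2 * m)) with h | h
  · rw [min_eq_left h, mul_one]
    have : diffSymbol m ξ y ≤ 4 ^ m :=
      pow_le_pow_left₀ h0 (by linarith [Real.neg_one_le_cos θ]) _
    have : 0 ≤ (2 * Real.pi * ‖ξ‖) ^ (2 * m) := by positivity
    linarith
  · rw [min_eq_right h]
    have h1 : diffSymbol m ξ y ≤ (θ ^ 2) ^ m :=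
      pow_le_pow_left₀ h0 (by linarith [Real.one_sub_sq_div_two_le_cos (x := θ)]) _
    have h2 : θ ^ 2 ≤ (2 * Real.pi * ‖ξ‖ * ‖y‖) ^ 2 := by
      rw [← sq_abs θ, hθ, abs_mul, abs_of_pos (by positivity : 0 < 2 * Real.pi)]
      have := abs_real_inner_le_norm y ξ
      have h3 : 2 * Real.pi * |inner ℝ y ξ| ≤ 2 * Real.pi * ‖ξ‖ * ‖y‖ := by
        rw [mul_assoc _ ‖ξ‖, mul_comm ‖ξ‖]; gcongr
      gcongr
    have h4 : (θ ^ 2) ^ m ≤ (2 * Real.pi * ‖ξ‖) ^ (2 * m) * ‖y‖ ^ (2 * m) := by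
      rw [← mul_pow, pow_mul]
      exact pow_le_pow_left₀ (sq_nonneg _) h2 _
    have : 0 ≤ (4 : ℝ) ^ m * ‖y‖ ^ (2 * m) := by positivity
    linarith [add_mul ((4 : ℝ) ^ m) ((2 * Real.pi * ‖ξ‖) ^ (2 * m)) (‖y‖ ^ (2 * m))]

lemma integrable_diffSymbol_mul [Nontrivial E] {ρ : ℝ} (hρ : 0 < ρ) {m : ℕ} (hm : ρ < m) (ξ : E) :
    Integrable (fun y : E => diffSymbol m ξ y * rieszKernel ρ y) := by
  refine ((integrable_min_mul_rieszKernel hρ hm).const_mul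
    (4 ^ m + (2 * Real.pi * ‖ξ‖) ^ (2 * m))).mono' ?_ (Filter.Eventually.of_forall fun y => ?_)
  · refine AEStronglyMeasurable.mul ?_ (measurable_rieszKernel ρ).aestronglyMeasurable
    exact ((continuous_diffSymbol m).comp (Continuous.prodMk_right ξ)).aestronglyMeasurable
  · rw [Real.norm_eq_abs, abs_of_nonneg (mul_nonneg (diffSymbol_nonneg m ξ y)
      (rieszKernel_nonneg ρ y)), ← mul_assoc]
    exact mul_le_mul_of_nonneg_right (diffSymbol_le m ξ y) (rieszKernel_nonneg ρ y)

/-- The symbol depends on `ξ` and `y` only through their inner product, so the dilation moves onto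
`y`; the kernel's homogeneity and the Jacobian combine to `r^(2ρ)`. -/
lemma integral_diffSymbol_smul {ρ : ℝ} (m : ℕ) {r : ℝ} (hr : 0 < r) (ξ : E) :
    ∫ y : E, diffSymbol m (r • ξ) y * rieszKernel ρ y =
      r ^ (2 * ρ) * ∫ y : E, diffSymbol m ξ y * rieszKernel ρ y := by
  have h := Measure.integral_comp_smul (volume : Measure E)
    (fun y => diffSymbol m ξ y * rieszKernel ρ y) r
  have h2 : ∀ y : E, diffSymbol m ξ (r • y) * rieszKernel ρ (r • y) =
      r ^ (-((Module.finrank ℝ E : ℝ) + 2 * ρ)) *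
        (diffSymbol m (r • ξ) y * rieszKernel ρ y) := by
    intro y
    rw [rieszKernel_smul hr]
    simp only [diffSymbol, real_inner_smul_left, real_inner_smul_right]
    ring
  simp_rw [h2] at h
  rw [integral_const_mul, smul_eq_mul, abs_of_pos (by positivity)] at h
  have e1 : (r ^ Module.finrank ℝ E)⁻¹ = r ^ (-(Module.finrank ℝ E : ℝ)) := by
    rw [Real.rpow_neg hr.le, Real.rpow_natCast]
  have e2 : r ^ (-((Module.finrank ℝ E : ℝ) + 2 * ρ)) =
      r ^ (-(Module.finrank ℝ E : ℝ)) * (r ^ (2 * ρ))⁻¹ := by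
    rw [neg_add, Real.rpow_add hr, Real.rpow_neg hr.le (2 * ρ)]
  rw [e1, e2, mul_assoc] at h
  have h3 := mul_left_cancel₀ (Real.rpow_pos_of_pos hr _).ne' h
  rwa [inv_mul_eq_iff_eq_mul₀ (Real.rpow_pos_of_pos hr _).ne'] at h3

/-- The kernel is radial, and the reflection in the hyperplane orthogonal to `ξ - ζ` is a
measure-preserving isometry carrying `ξ` to `ζ`. -/
lemma integral_diffSymbol_eq_of_norm_eq {ρ : ℝ} (m : ℕ) {ξ ζ : E} (h : ‖ξ‖ = ‖ζ‖) :
    ∫ y : E, diffSymbol m ξ y * rieszKernel ρ y =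
      ∫ y : E, diffSymbol m ζ y * rieszKernel ρ y := by
  set A : E ≃ₗᵢ[ℝ] E := (Submodule.span ℝ {ξ - ζ})ᗮ.reflection
  have hA : A ξ = ζ := Submodule.reflection_sub h
  have h1 := (A.measurePreserving.integral_comp A.toHomeomorph.measurableEmbedding
    (fun y => diffSymbol m ζ y * rieszKernel ρ y))
  rw [← h1]
  congr 1
  ext y
  simp only [diffSymbol, rieszKernel]
  rw [← hA, A.inner_map_map, A.norm_map]

/-- The integral of the difference symbol against the kernel is a positive multiple of the symbol
of the fractional Laplacian. -/
lemma exists_integral_diffSymbol_eq [Nontrivial E] {ρ : ℝ} (hρ : 0 < ρ) {m : ℕ} (hm : ρ < m) :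
    ∃ c > 0, ∀ ξ : E, ∫ y : E, diffSymbol m ξ y * rieszKernel ρ y =
      c * (2 * Real.pi * ‖ξ‖) ^ (2 * ρ) := by
  have hm0 : m ≠ 0 := by
    rintro rfl
    simp only [Nat.cast_zero] at hm
    linarith
  obtain ⟨e, he⟩ : ∃ e : E, ‖e‖ = 1 := exists_norm_eq E zero_le_one
  set I := ∫ y : E, diffSymbol m e y * rieszKernel ρ y with hI
  have hIpos : 0 < I := by
    rw [hI, integral_pos_iff_support_of_nonneg
      (fun y => mul_nonneg (diffSymbol_nonneg m e y) (rieszKernel_nonneg ρ y))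
      (integrable_diffSymbol_mul hρ hm e)]
    have hopen : IsOpen {y : E | Real.cos (2 * Real.pi * inner ℝ y e) < 1} :=
      isOpen_lt (by fun_prop) continuous_const
    -- The open set is nonempty because at `y = e / 2` the angle is `π` and the cosine is `-1`.
    refine (hopen.measure_pos volume ⟨(1 / 2 : ℝ) • e, ?_⟩).trans_le (measure_mono fun y hy => ?_)
    · have : 2 * Real.pi * (1 / 2 * (1 : ℝ)) = Real.pi := by ring
      simp only [mem_ofPred_eq, real_inner_smul_left, real_inner_self_eq_norm_sq, he, one_pow, this,
        Real.cos_pi]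
      norm_num
    · have hy' : Real.cos (2 * Real.pi * inner ℝ y e) < 1 := hy
      have hy0 : y ≠ 0 := by rintro rfl; simp at hy'
      have h1 : 0 < diffSymbol m e y := pow_pos (by linarith) _
      have h2 : 0 < rieszKernel ρ y := Real.rpow_pos_of_pos (norm_pos_iff.2 hy0) _
      exact (mul_pos h1 h2).ne'
  have hπ : (0 : ℝ) < (2 * Real.pi) ^ (2 * ρ) := by positivity
  refine ⟨I / (2 * Real.pi) ^ (2 * ρ), by positivity, fun ξ => ?_⟩
  rcases eq_or_ne ξ 0 with rfl | hξ
  · simp [diffSymbol, Real.zero_rpow (by linarith : 2 * ρ ≠ 0), hm0]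
  · have hn : 0 < ‖ξ‖ := norm_pos_iff.2 hξ
    have h1 : ‖ξ‖ = ‖‖ξ‖ • e‖ := by simp [norm_smul, he]
    rw [integral_diffSymbol_eq_of_norm_eq m h1, integral_diffSymbol_smul m hn,
      Real.mul_rpow (by positivity) hn.le, ← hI]
    field_simp

/-- The symmetric difference of order `2m` of `f` at `x` with increment `y`. -/
def symmDiffOp (m : ℕ) (f : E → ℝ) (x y : E) : ℝ :=
  ∑ j ∈ Finset.range (2 * m + 1),
    (-1) ^ (m + j) * ((2 * m).choose j : ℝ) * f (x + ((j : ℝ) - m) • y)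

/-- With `z = exp (iθ)` one has `2 - 2 cos θ = -(z - 1)² / z`; expand `(z - 1)^(2m)` binomially. The
coefficients are those of `symmDiffOp`, which identifies `diffSymbol` as its Fourier symbol. -/
lemma two_sub_two_cos_pow (m : ℕ) (θ : ℝ) :
    (((2 - 2 * Real.cos θ) ^ m : ℝ) : ℂ) = ∑ j ∈ Finset.range (2 * m + 1),
      (((-1) ^ (m + j) * ((2 * m).choose j : ℝ) : ℝ) : ℂ) *
        Complex.exp (((((j : ℝ) - m) * θ : ℝ) : ℂ) * Complex.I) := by
  set z := Complex.exp (θ * Complex.I) with hz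
  have hz0 : z ≠ 0 := Complex.exp_ne_zero _
  have h1 : ((2 - 2 * Real.cos θ : ℝ) : ℂ) = -(z - 1) ^ 2 * z⁻¹ := by
    have : z⁻¹ = Complex.exp (-(θ : ℂ) * Complex.I) := by
      rw [hz, ← Complex.exp_neg]; ring_nf
    push_cast
    have h2 := Complex.two_cos (θ : ℂ)
    rw [← hz, ← this] at h2
    rw [h2]
    field_simp
    ring
  have h3 : ∀ j : ℕ, Complex.exp (((((j : ℝ) - m) * θ : ℝ) : ℂ) * Complex.I) =
      z ^ j * (z⁻¹) ^ m := by
    intro j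
    rw [hz, ← Complex.exp_neg, ← Complex.exp_nat_mul, ← Complex.exp_nat_mul, ← Complex.exp_add]
    congr 1
    push_cast
    ring
  rw [Complex.ofReal_pow, h1, mul_pow, neg_pow, ← pow_mul, sub_pow, Finset.mul_sum, Finset.sum_mul]
  refine Finset.sum_congr rfl fun j _ => ?_
  rw [h3]
  push_cast
  have h4 : ((-1 : ℂ)) ^ (j + 2 * m) = (-1) ^ j := by
    rw [pow_add, pow_mul (-1 : ℂ) 2 m]; norm_num
  rw [h4, one_pow]
  ring

end Kernel

/-! ### The fractional Laplacian as an integral of symmetric differences. -/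

section Representation

variable {n : ℕ}

/-- The complexification of a real test function as a Schwartz function. -/
def schwartzOfReal {f : EuclideanSpace ℝ (Fin n) → ℝ} (hf : ContDiff ℝ ∞ f)
    (hc : HasCompactSupport f) : SchwartzMap (EuclideanSpace ℝ (Fin n)) ℂ :=
  (hc.comp_left (g := fun t : ℝ => (t : ℂ)) Complex.ofReal_zero).toSchwartzMap
    (Complex.ofRealCLM.contDiff.comp hf)

lemma schwartzOfReal_apply {f : EuclideanSpace ℝ (Fin n) → ℝ} (hf : ContDiff ℝ ∞ f)
    (hc : HasCompactSupport f) (x) : schwartzOfReal hf hc x = (f x : ℂ) := rfl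

lemma fourier_ofReal_eq {f : EuclideanSpace ℝ (Fin n) → ℝ} (hf : ContDiff ℝ ∞ f)
    (hc : HasCompactSupport f) :
    𝓕 (fun y => (f y : ℂ)) =
      ⇑(𝓕 (schwartzOfReal hf hc) : SchwartzMap (EuclideanSpace ℝ (Fin n)) ℂ) := rfl

lemma integral_cexp_mul_fourier {f : EuclideanSpace ℝ (Fin n) → ℝ} (hf : ContDiff ℝ ∞ f)
    (hc : HasCompactSupport f) (x : EuclideanSpace ℝ (Fin n)) :
    ∫ ξ, Complex.exp (((2 * Real.pi * inner ℝ ξ x : ℝ) : ℂ) * Complex.I) *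
      𝓕 (fun y => (f y : ℂ)) ξ = f x := by
  have h := congrArg (fun g : SchwartzMap (EuclideanSpace ℝ (Fin n)) ℂ => g x)
    (FourierTransform.fourierInv_fourier_eq
      (F := SchwartzMap (EuclideanSpace ℝ (Fin n)) ℂ) (schwartzOfReal hf hc))
  simp only [SchwartzMap.fourierInv_coe] at h
  rw [Real.fourierInv_eq', schwartzOfReal_apply] at h
  simpa [fourier_ofReal_eq hf hc] using h

/-- The Fourier transform is Schwartz and `‖ξ‖ ^ s ≤ 1 + ‖ξ‖ ^ k` for a natural `k ≥ s`. With `s =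
2ρ` this supplies the absolute convergence needed for Fubini. -/
lemma integrable_rpow_mul_fourier {f : EuclideanSpace ℝ (Fin n) → ℝ} (hf : ContDiff ℝ ∞ f)
    (hc : HasCompactSupport f) {s : ℝ} (hs : 0 ≤ s) :
    Integrable fun ξ : EuclideanSpace ℝ (Fin n) => ‖ξ‖ ^ s * ‖𝓕 (fun y => (f y : ℂ)) ξ‖ := by
  obtain ⟨k, hk⟩ := exists_nat_ge s
  rw [fourier_ofReal_eq hf hc]
  set g : SchwartzMap (EuclideanSpace ℝ (Fin n)) ℂ := 𝓕 (schwartzOfReal hf hc)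
  have h0 := g.integrable_pow_mul (volume : Measure (EuclideanSpace ℝ (Fin n))) 0
  have h1 := g.integrable_pow_mul (volume : Measure (EuclideanSpace ℝ (Fin n))) k
  refine (h0.add h1).mono' ?_ (Filter.Eventually.of_forall fun ξ => ?_)
  · have : Continuous fun ξ : EuclideanSpace ℝ (Fin n) => ‖ξ‖ ^ s * ‖g ξ‖ :=
      (continuous_norm.rpow_const (fun _ => Or.inr hs)).mul g.continuous.norm
    exact this.aestronglyMeasurable
  · simp only [Pi.add_apply, pow_zero, one_mul, Real.norm_eq_abs]
    rw [abs_of_nonneg (by positivity)]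
    have h2 : ‖ξ‖ ^ s ≤ 1 + ‖ξ‖ ^ k := by
      rcases le_total ‖ξ‖ 1 with h | h
      · exact (Real.rpow_le_one (norm_nonneg _) h hs).trans (by linarith [pow_nonneg (norm_nonneg ξ) k])
      · have := Real.rpow_le_rpow_of_exponent_le h hk
        rw [Real.rpow_natCast] at this
        linarith
    calc _ ≤ (1 + ‖ξ‖ ^ k) * ‖g ξ‖ := by gcongr
      _ = _ := by ring

/-- Difference representation of the fractional Laplacian of arbitrary positive order. -/
lemma exists_fracLaplacian_eq_integral (hn : n ≠ 0) {ρ : ℝ} (hρ : 0 < ρ) {m : ℕ} (hm : ρ < m) :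
    ∃ c > 0, ∀ f : EuclideanSpace ℝ (Fin n) → ℝ, ContDiff ℝ ∞ f → HasCompactSupport f → ∀ x,
      c * fracLaplacian ρ f x = ∫ y, symmDiffOp m f x y * rieszKernel ρ y := by
  have : Nonempty (Fin n) := Fin.pos_iff_nonempty.1 (Nat.pos_of_ne_zero hn)
  obtain ⟨c, hc, hcI⟩ := exists_integral_diffSymbol_eq (E := EuclideanSpace ℝ (Fin n)) hρ hm
  refine ⟨c, hc, fun f hf hfc x => ?_⟩
  set F := 𝓕 (fun y => (f y : ℂ)) with hF
  have hFc : Continuous F := by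
    rw [hF, fourier_ofReal_eq hf hfc]; 
    exact (𝓕 (schwartzOfReal hf hfc) : SchwartzMap (EuclideanSpace ℝ (Fin n)) ℂ).continuous
  have hFi : Integrable F := by
    have h := integrable_rpow_mul_fourier hf hfc le_rfl
    simp only [Real.rpow_zero, one_mul] at h
    exact (integrable_norm_iff hFc.aestronglyMeasurable).1 h
  -- Fubini for `G` is the whole proof: integrating first in `ξ` produces the symmetric difference
  -- by Fourier inversion, and integrating first in `y` produces `c` times the multiplier.
  let G : EuclideanSpace ℝ (Fin n) → EuclideanSpace ℝ (Fin n) → ℂ := fun y ξ =>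
    ((diffSymbol m ξ y * rieszKernel ρ y : ℝ) : ℂ) *
      (Complex.exp (((2 * Real.pi * inner ℝ ξ x : ℝ) : ℂ) * Complex.I) * F ξ)
  have hnorm : ∀ y ξ, ‖G y ξ‖ = diffSymbol m ξ y * rieszKernel ρ y * ‖F ξ‖ := by
    intro y ξ
    rw [norm_mul, norm_mul, Complex.norm_exp_ofReal_mul_I, one_mul, Complex.norm_real,
      Real.norm_eq_abs, abs_of_nonneg (mul_nonneg (diffSymbol_nonneg m ξ y)
      (rieszKernel_nonneg ρ y))]
  have hGm : AEStronglyMeasurable (Function.uncurry G) (volume.prod volume) := by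
    have h1 : Measurable fun z : EuclideanSpace ℝ (Fin n) × EuclideanSpace ℝ (Fin n) =>
        diffSymbol m z.2 z.1 * rieszKernel ρ z.1 :=
      (((continuous_diffSymbol m).comp continuous_swap).measurable).mul
        ((measurable_rieszKernel ρ).comp measurable_fst)
    have h2 : Continuous fun z : EuclideanSpace ℝ (Fin n) × EuclideanSpace ℝ (Fin n) =>
        Complex.exp (((2 * Real.pi * inner ℝ z.2 x : ℝ) : ℂ) * Complex.I) * F z.2 := by
      fun_prop
    exact ((Complex.measurable_ofReal.comp h1).mul h2.measurable).aestronglyMeasurable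
  have hGi : Integrable (Function.uncurry G) (volume.prod volume) := by
    rw [integrable_prod_iff' hGm]
    constructor
    · refine Filter.Eventually.of_forall fun ξ => ?_
      simp only [Function.uncurry_apply_pair, G]
      exact ((integrable_diffSymbol_mul hρ hm ξ).ofReal (𝕜 := ℂ)).mul_const _
    · simp only [Function.uncurry_apply_pair, hnorm]
      simp_rw [integral_mul_const, hcI]
      have h := (integrable_rpow_mul_fourier hf hfc (s := 2 * ρ) (by linarith)).const_mul
        (c * (2 * Real.pi) ^ (2 * ρ))
      refine h.congr (Filter.Eventually.of_forall fun ξ => ?_)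
      simp only
      rw [Real.mul_rpow (by positivity) (norm_nonneg ξ)]
      ring
  have hswap := integral_integral_swap hGi
  have hL : ∀ y, ∫ ξ, G y ξ = ((symmDiffOp m f x y * rieszKernel ρ y : ℝ) : ℂ) := by
    intro y
    have hterm : ∀ ξ, G y ξ = ∑ j ∈ Finset.range (2 * m + 1),
        ((rieszKernel ρ y : ℝ) : ℂ) * (((-1) ^ (m + j) * ((2 * m).choose j : ℝ) : ℝ) : ℂ) *
        (Complex.exp (((2 * Real.pi * inner ℝ ξ (x + ((j : ℝ) - m) • y) : ℝ) : ℂ) * Complex.I) *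
          F ξ) := by
      intro ξ
      simp only [G, diffSymbol]
      rw [Complex.ofReal_mul, two_sub_two_cos_pow, Finset.sum_mul, Finset.sum_mul]
      refine Finset.sum_congr rfl fun j _ => ?_
      have : Complex.exp (((2 * Real.pi * inner ℝ ξ (x + ((j : ℝ) - m) • y) : ℝ) : ℂ) *
          Complex.I) = Complex.exp (((((j : ℝ) - m) * (2 * Real.pi * inner ℝ y ξ) : ℝ) : ℂ) *
            Complex.I) *
          Complex.exp (((2 * Real.pi * inner ℝ ξ x : ℝ) : ℂ) * Complex.I) := by
        rw [← Complex.exp_add, inner_add_right, real_inner_smul_right, real_inner_comm ξ y]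
        congr 1
        push_cast
        ring
      rw [this]
      ring
    simp_rw [hterm]
    rw [integral_finsetSum]
    · simp_rw [integral_const_mul, hF, integral_cexp_mul_fourier hf hfc]
      rw [symmDiffOp]
      push_cast
      rw [Finset.sum_mul]
      exact Finset.sum_congr rfl fun j _ => by ring
    · intro j _
      refine Integrable.const_mul ?_ _
      refine hFi.bdd_mul (c := 1) (by fun_prop) (Filter.Eventually.of_forall fun ξ => ?_)
      rw [Complex.norm_exp_ofReal_mul_I]
  have hR : ∀ ξ, ∫ y, G y ξ = ((c : ℝ) : ℂ) *
      (Complex.exp (((2 * Real.pi * inner ℝ ξ x : ℝ) : ℂ) * Complex.I) •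
        ((((2 * Real.pi * ‖ξ‖) ^ (2 * ρ) : ℝ) : ℂ) * F ξ)) := by
    intro ξ
    simp only [G]
    rw [integral_mul_const, integral_complex_ofReal, hcI]
    push_cast
    rw [smul_eq_mul]
    ring
  simp_rw [hL, hR] at hswap
  rw [integral_const_mul, integral_complex_ofReal] at hswap
  have h := congrArg Complex.re hswap
  rw [Complex.ofReal_re, Complex.re_ofReal_mul] at h
  rw [h, fracLaplacian, Real.fourierInv_eq']

end Representation

/-! ### Nonvanishing of the tail coefficient via zeros of exponential sums. -/

section ExponentialSums

/-- An exponential sum with `m` distinct real frequencies and `m` distinct real zeros vanishes. -/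
lemma exponential_sum_coeff_eq_zero : ∀ (m : ℕ) (b lam x : Fin m → ℝ), Function.Injective lam →
    StrictMono x → (∀ k, ∑ i, b i * Real.exp (lam i * x k) = 0) → ∀ i, b i = 0
  | 0, _, _, _, _, _, _ => fun i => i.elim0
  | m + 1, b, lam, x, hlam, hx, h => by
    -- Dividing by `exp (lam 0 * s)` keeps the zeros and makes the term of index `0` constant, so
    -- differentiation removes it; Rolle leaves `m` zeros for the `m` remaining frequencies.
    set G : ℝ → ℝ := fun s => ∑ i, b i * Real.exp ((lam i - lam 0) * s) with hG
    have hG0 : ∀ k, G (x k) = 0 := by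
      intro k
      have : G (x k) = Real.exp (-(lam 0 * x k)) * ∑ i, b i * Real.exp (lam i * x k) := by
        rw [hG, Finset.mul_sum]
        refine Finset.sum_congr rfl fun i _ => ?_
        rw [mul_left_comm, ← Real.exp_add]
        congr 2; ring
      rw [this, h k, mul_zero]
    have hGd : ∀ s, HasDerivAt G
        (∑ i, b i * (Real.exp ((lam i - lam 0) * s) * (lam i - lam 0))) s := by
      intro s
      refine HasDerivAt.fun_sum fun i _ => HasDerivAt.const_mul _ ?_
      have := ((hasDerivAt_id s).const_mul (lam i - lam 0)).exp
      simpa using this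
    have hrolle : ∀ k : Fin m, ∃ y ∈ Ioo (x k.castSucc) (x k.succ), deriv G y = 0 := fun k =>
      exists_deriv_eq_zero (hx (Fin.castSucc_lt_succ))
        (fun s _ => (hGd s).continuousAt.continuousWithinAt) (by rw [hG0, hG0])
    choose y hy hy0 using hrolle
    have hymono : StrictMono y := by
      intro i j hij
      calc y i < x i.succ := (hy i).2
        _ ≤ x j.castSucc := hx.monotone (Fin.succ_le_castSucc_iff.2 hij)
        _ < y j := (hy j).1
    have ih := exponential_sum_coeff_eq_zero m (fun i => b i.succ * (lam i.succ - lam 0))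
      (fun i => lam i.succ - lam 0) y
      (fun i j hij => Fin.succ_injective _ (hlam (by simpa using hij))) hymono (fun k => by
        have := hy0 k
        rw [(hGd _).deriv, Fin.sum_univ_succ] at this
        simp only [sub_self, mul_zero, zero_add] at this
        rw [← this]
        exact Finset.sum_congr rfl fun i _ => by ring)
    have hsucc : ∀ i : Fin m, b i.succ = 0 := by
      intro i
      have h1 : lam i.succ - lam 0 ≠ 0 :=
        sub_ne_zero.2 fun h => Fin.succ_ne_zero i (hlam h)
      exact (mul_eq_zero.1 (ih i)).resolve_right h1
    intro i
    refine Fin.cases ?_ hsucc i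
    have := h 0
    rw [Fin.sum_univ_succ] at this
    simpa [hsucc, Real.exp_ne_zero] using this

/-- The coefficient produced by the symmetric difference of order `2m` of `|·|^(2s)` at `0`. -/
def diffCoeff (m : ℕ) (s : ℝ) : ℝ :=
  ∑ j ∈ Finset.range (2 * m + 1),
    (-1) ^ (m + j) * ((2 * m).choose j : ℝ) * |(j : ℝ) - m| ^ (2 * s)

/-- At integer exponents `|t|^(2k) = t^(2k)` is a polynomial of degree below `2m`, so a difference
of order `2m` annihilates it. -/
lemma diffCoeff_natCast {m k : ℕ} (hk : k < m) : diffCoeff m k = 0 := by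
  have h := Polynomial.fwdDiff_iter_eq_zero_of_degree_lt (R := ℝ)
    (P := (Polynomial.X - Polynomial.C (m : ℝ)) ^ (2 * k)) (n := 2 * m)
    (by rw [Polynomial.natDegree_pow, Polynomial.natDegree_X_sub_C]; omega)
  have h0 := congrFun h 0
  rw [fwdDiff_iter_eq_sum_shift] at h0
  have h1 : diffCoeff m k = (-1) ^ m * 0 := by
    rw [← Pi.zero_apply (M := fun _ : ℝ => ℝ) (0 : ℝ), ← h0, diffCoeff, Finset.mul_sum]
    refine Finset.sum_congr rfl fun j hj => ?_
    have hj' : j ≤ 2 * m := by simpa [Nat.lt_succ_iff] using hj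
    have e1 : (-1 : ℝ) ^ (2 * m - j) = (-1) ^ j := by
      have : (-1 : ℝ) ^ (2 * m - j) * (-1) ^ j = 1 := by
        rw [← pow_add, Nat.sub_add_cancel hj', pow_mul]; norm_num
      have h2 : (-1 : ℝ) ^ j * (-1) ^ j = 1 := by rw [← mul_pow]; norm_num
      exact mul_right_cancel₀ (pow_ne_zero j (by norm_num : (-1 : ℝ) ≠ 0)) (this.trans h2.symm)
    have e2 : |(j : ℝ) - m| ^ (2 * (k : ℝ)) = ((j : ℝ) - m) ^ (2 * k) := by
      rw [show (2 * (k : ℝ)) = ((2 * k : ℕ) : ℝ) by push_cast; ring, Real.rpow_natCast,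
        (even_two_mul k).pow_abs]
    rw [e2]
    simp only [Polynomial.eval_pow, Polynomial.eval_sub, Polynomial.eval_X, Polynomial.eval_C,
      zero_add, nsmul_eq_mul, mul_one, zsmul_eq_mul]
    push_cast
    rw [e1, pow_add]
    ring
  simpa using h1

/-- Pair `j = m + (i+1)` with `j = m - (i+1)`; the middle term is `0 ^ (2s)`, which vanishes since
`s > 0`. As a function of `s` this is an exponential sum with the `m` distinct frequencies `2 log
(i+1)`. -/
lemma diffCoeff_eq_sum {m : ℕ} {s : ℝ} (hs : 0 < s) :
    diffCoeff m s = 2 * ∑ i : Fin m, (-1) ^ ((i : ℕ) + 1) * ((2 * m).choose (m + 1 + i) : ℝ) *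
      Real.exp (2 * Real.log ((i : ℝ) + 1) * s) := by
  have hexp : ∀ i : ℕ, ((i : ℝ) + 1) ^ (2 * s) = Real.exp (2 * Real.log ((i : ℝ) + 1) * s) := by
    intro i
    rw [Real.rpow_def_of_pos (by positivity)]
    congr 1; ring
  have hsq : ∀ l : ℕ, (-1 : ℝ) ^ (2 * l) = 1 := fun l => by rw [pow_mul]; norm_num
  rw [diffCoeff, show 2 * m + 1 = m + (m + 1) by ring, Finset.sum_range_add,
    ← Finset.sum_range_reflect, Finset.sum_range_succ']
  have h0 : |((m + 0 : ℕ) : ℝ) - m| ^ (2 * s) = 0 := by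
    simp [Real.zero_rpow (by linarith : 2 * s ≠ 0)]
  rw [h0, mul_zero, add_zero, ← Finset.sum_add_distrib, Finset.mul_sum,
    Fin.sum_univ_eq_sum_range (fun i => 2 * ((-1 : ℝ) ^ (i + 1) *
      ((2 * m).choose (m + 1 + i) : ℝ) * Real.exp (2 * Real.log ((i : ℝ) + 1) * s)))]
  refine Finset.sum_congr rfl fun i hi => ?_
  rw [Finset.mem_range] at hi
  have c1 : ((m - 1 - i : ℕ) : ℝ) = m - 1 - i := by
    rw [Nat.cast_sub (by omega), Nat.cast_sub (by omega)]; simp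
  have a1 : |((m - 1 - i : ℕ) : ℝ) - m| = (i : ℝ) + 1 := by
    rw [c1, show (m : ℝ) - 1 - i - m = -((i : ℝ) + 1) by ring, abs_neg, abs_of_pos (by positivity)]
  have a2 : |((m + (i + 1) : ℕ) : ℝ) - m| = (i : ℝ) + 1 := by
    push_cast
    rw [add_sub_cancel_left, abs_of_pos (by positivity)]
  have s1 : (-1 : ℝ) ^ (m + (m - 1 - i)) = (-1) ^ (i + 1) := by
    have h : (-1 : ℝ) ^ (m + (m - 1 - i)) * (-1) ^ (i + 1) = 1 := by
      rw [← pow_add, show m + (m - 1 - i) + (i + 1) = 2 * m by omega, hsq]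
    have h2 : (-1 : ℝ) ^ (i + 1) * (-1) ^ (i + 1) = 1 := by rw [← mul_pow]; norm_num
    exact mul_right_cancel₀ (pow_ne_zero _ (by norm_num : (-1 : ℝ) ≠ 0)) (h.trans h2.symm)
  have s2 : (-1 : ℝ) ^ (m + (m + (i + 1))) = (-1) ^ (i + 1) := by
    rw [show m + (m + (i + 1)) = 2 * m + (i + 1) by ring, pow_add, hsq, one_mul]
  have ch : (2 * m).choose (m - 1 - i) = (2 * m).choose (m + 1 + i) := by
    rw [← Nat.choose_symm (by omega : m + 1 + i ≤ 2 * m)]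
    congr 1; omega
  rw [a1, a2, s1, s2, ch, hexp, show m + (i + 1) = m + 1 + i by ring]
  ring

/-- The coefficient does not vanish at non-integer exponents. -/
lemma diffCoeff_ne_zero {m : ℕ} {ρ : ℝ} (hρ : 0 < ρ) (hm : ρ < m) (hint : ∀ k : ℕ, ρ ≠ k) :
    diffCoeff m ρ ≠ 0 := by
  intro hA
  have hm1 : 1 ≤ m := by
    by_contra h
    have : m = 0 := by omega
    subst this
    simp only [Nat.cast_zero] at hm; linarith
  -- If the coefficient vanished at `ρ`, then `ρ` together with `1, …, m-1` would be `m` distinct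
  -- zeros of a sum with `m` frequencies.
  let S : Finset ℝ := insert ρ ((Finset.Icc 1 (m - 1)).image (fun k : ℕ => (k : ℝ)))
  have hcard : S.card = m := by
    rw [Finset.card_insert_of_notMem, Finset.card_image_of_injective _ Nat.cast_injective,
      Nat.card_Icc]
    · omega
    · simp only [Finset.mem_image, not_exists, not_and]
      exact fun k _ h => hint k h.symm
  have hS : ∀ s ∈ S, 0 < s ∧ diffCoeff m s = 0 := by
    intro s hs
    rcases Finset.mem_insert.1 hs with rfl | hs
    · exact ⟨hρ, hA⟩
    · obtain ⟨k, hk, rfl⟩ := Finset.mem_image.1 hs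
      rw [Finset.mem_Icc] at hk
      exact ⟨by exact_mod_cast hk.1, diffCoeff_natCast (by omega)⟩
  have key := exponential_sum_coeff_eq_zero m
    (fun i => (-1) ^ ((i : ℕ) + 1) * ((2 * m).choose (m + 1 + i) : ℝ))
    (fun i => 2 * Real.log ((i : ℝ) + 1)) (S.orderEmbOfFin hcard)
    (fun i j hij => by
      have h1 : Real.log ((i : ℝ) + 1) = Real.log ((j : ℝ) + 1) := by simpa using hij
      have h2 := Real.log_injOn_pos (by simp only [mem_Ioi]; positivity)
        (by simp only [mem_Ioi]; positivity) h1
      exact Fin.ext (by exact_mod_cast add_right_cancel h2))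
    (S.orderEmbOfFin hcard).strictMono
    (fun k => by
      obtain ⟨h0, h1⟩ := hS _ (S.orderEmbOfFin_mem hcard k)
      rw [diffCoeff_eq_sum h0] at h1
      linarith)
    ⟨m - 1, by omega⟩
  -- The contradiction is read off the top frequency `i = m - 1`, whose coefficient is `±1`.
  have hc : (2 * m).choose (m + 1 + (m - 1)) = 1 := by
    rw [show m + 1 + (m - 1) = 2 * m by omega, Nat.choose_self]
  simp only [hc, Nat.cast_one, mul_one] at key
  exact pow_ne_zero _ (by norm_num : (-1 : ℝ) ≠ 0) key

end ExponentialSums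

/-! ### Size of symmetric differences in terms of derivatives. -/

section FiniteDifferences

lemma natCast_le_infty (i : ℕ) : (i : WithTop ℕ∞) ≤ ∞ := by exact_mod_cast le_top

/-- The `N`-th forward difference is bounded by the `N`-th derivative. -/
lemma abs_fwdDiff_iter_le (N : ℕ) : ∀ (h : ℝ → ℝ), ContDiff ℝ ∞ h → ∀ (a M : ℝ),
    (∀ t ∈ Icc a (a + N), |iteratedDeriv N h t| ≤ M) → |(fwdDiff (1 : ℝ))^[N] h a| ≤ M := by
  induction N with
  | zero =>
    intro h _ a M hM
    simpa using hM a (by simp)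
  | succ N ih =>
    intro h hh a M hM
    rw [Function.iterate_succ_apply]
    have hs : ContDiff ℝ ∞ (fun t : ℝ => h (t + 1)) := hh.comp (contDiff_id.add contDiff_const)
    refine ih _ (hs.sub hh) a M fun t ht => ?_
    have e1 : iteratedDeriv N (fwdDiff (1 : ℝ) h) t =
        iteratedDeriv N h (t + 1) - iteratedDeriv N h t := by
      have := iteratedDeriv_fun_sub (n := N) (x := t) (f := fun t : ℝ => h (t + 1)) (g := h)
        (hs.contDiffAt.of_le (by exact_mod_cast le_top))
        (hh.contDiffAt.of_le (by exact_mod_cast le_top))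
      rw [iteratedDeriv_comp_add_const] at this
      exact this
    have hd : ∀ s, DifferentiableAt ℝ (iteratedDeriv N h) s := fun s =>
      (hh.differentiable_iteratedDeriv N (by exact_mod_cast ENat.natCast_lt_top N)) s
    -- One difference is traded for one derivative by the mean value inequality on `[t, t+1]`, which
    -- stays inside `[a, a + N + 1]`.
    have h3 := (convex_Icc t (t + 1)).norm_image_sub_le_of_norm_deriv_le (f := iteratedDeriv N h)
      (C := M) (fun s _ => hd s) (fun s hs => by
        rw [← iteratedDeriv_succ, Real.norm_eq_abs]
        refine hM s ⟨ht.1.trans hs.1, hs.2.trans ?_⟩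
        push_cast
        linarith [ht.2]) (left_mem_Icc.2 (by linarith)) (right_mem_Icc.2 (by linarith))
    change |iteratedDeriv N (fwdDiff (1 : ℝ) h) t| ≤ M
    rw [e1]
    simpa using h3

variable {E : Type*} [NormedAddCommGroup E] [InnerProductSpace ℝ E] [FiniteDimensional ℝ E]
  [MeasurableSpace E] [BorelSpace E]

lemma symmDiffOp_eq_fwdDiff (m : ℕ) (f : E → ℝ) (x y : E) :
    symmDiffOp m f x y =
      (-1) ^ m * (fwdDiff (1 : ℝ))^[2 * m] (fun t => f (x - (m : ℝ) • y + t • y)) 0 := by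
  rw [fwdDiff_iter_eq_sum_shift, symmDiffOp, Finset.mul_sum]
  refine Finset.sum_congr rfl fun j hj => ?_
  have hj' : j ≤ 2 * m := by simpa [Nat.lt_succ_iff] using hj
  have e1 : (-1 : ℝ) ^ (2 * m - j) = (-1) ^ j := by
    have : (-1 : ℝ) ^ (2 * m - j) * (-1) ^ j = 1 := by
      rw [← pow_add, Nat.sub_add_cancel hj', pow_mul]; norm_num
    have h2 : (-1 : ℝ) ^ j * (-1) ^ j = 1 := by rw [← mul_pow]; norm_num
    exact mul_right_cancel₀ (pow_ne_zero j (by norm_num : (-1 : ℝ) ≠ 0)) (this.trans h2.symm)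
  have e2 : x - (m : ℝ) • y + ((0 : ℝ) + j • (1 : ℝ)) • y = x + ((j : ℝ) - m) • y := by
    rw [zero_add, nsmul_eq_mul, mul_one, sub_smul]; abel
  rw [e2, zsmul_eq_mul]
  push_cast
  rw [e1, pow_add]
  ring

/-- Restrict `f` to the line through `x` in direction `y`: each of the `2m` derivatives along it
contributes a factor `‖y‖`, and the segment used stays within distance `m` of `x` because `‖y‖ ≤ 1`.
-/
lemma abs_symmDiffOp_le {m : ℕ} {f : E → ℝ} (hf : ContDiff ℝ ∞ f) {x y : E} {M : ℝ}
    (hy : ‖y‖ ≤ 1) (hM : ∀ z, ‖x - z‖ ≤ m → ‖iteratedFDeriv ℝ (2 * m) f z‖ ≤ M) :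
    |symmDiffOp m f x y| ≤ M * ‖y‖ ^ (2 * m) := by
  rw [symmDiffOp_eq_fwdDiff, abs_mul, abs_pow, abs_neg, abs_one, one_pow, one_mul]
  set a : E := x - (m : ℝ) • y with ha
  have hfa : ContDiff ℝ ∞ (fun z => f (a + z)) := hf.comp (contDiff_const.add contDiff_id)
  have hcomp : (fun t : ℝ => f (a + t • y)) =
      (fun z => f (a + z)) ∘ (ContinuousLinearMap.toSpanSingleton ℝ y) := by
    ext t; simp
  refine abs_fwdDiff_iter_le (2 * m) _ ?_ 0 _ fun t ht => ?_
  · rw [hcomp]; exact hfa.comp (ContinuousLinearMap.contDiff _)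
  · rw [← Real.norm_eq_abs, ← norm_iteratedFDeriv_eq_norm_iteratedDeriv, hcomp,
      ContinuousLinearMap.iteratedFDeriv_comp_right _ hfa _ (natCast_le_infty _)]
    refine (ContinuousMultilinearMap.norm_compContinuousLinearMap_le _ _).trans ?_
    rw [Finset.prod_const, Finset.card_univ, Fintype.card_fin,
      ContinuousLinearMap.norm_toSpanSingleton, iteratedFDeriv_comp_add_left]
    gcongr
    apply hM
    have e : x - (a + (ContinuousLinearMap.toSpanSingleton ℝ y) t) = ((m : ℝ) - t) • y := by
      simp only [ha, ContinuousLinearMap.toSpanSingleton_apply, sub_smul]; abel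
    rw [e, norm_smul, Real.norm_eq_abs]
    have h1 : |(m : ℝ) - t| ≤ m := by
      have h2 := ht.2
      push_cast at h2
      rw [abs_le]; constructor <;> linarith [ht.1]
    calc _ ≤ (m : ℝ) * 1 := by gcongr
      _ = m := mul_one _

lemma abs_symmDiffOp_le_sum (m : ℕ) (f : E → ℝ) (x y : E) :
    |symmDiffOp m f x y| ≤ ∑ j ∈ Finset.range (2 * m + 1),
      ((2 * m).choose j : ℝ) * |f (x + ((j : ℝ) - m) • y)| := by
  refine (Finset.abs_sum_le_sum_abs _ _).trans (Finset.sum_le_sum fun j _ => ?_)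
  rw [abs_mul, abs_mul, abs_pow, abs_neg, abs_one, one_pow, one_mul,
    abs_of_nonneg (Nat.cast_nonneg _)]

end FiniteDifferences

/-! ### Locality of the operator at integer order. -/

section IntegerOrder

variable {n : ℕ}

open LineDeriv in
lemma norm_iteratedFDeriv_lineDerivOp_le (g : SchwartzMap (EuclideanSpace ℝ (Fin n)) ℂ)
    (v : EuclideanSpace ℝ (Fin n)) (j : ℕ) (x : EuclideanSpace ℝ (Fin n)) :
    ‖iteratedFDeriv ℝ j (∂_{v} g : SchwartzMap (EuclideanSpace ℝ (Fin n)) ℂ) x‖ ≤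
      ‖v‖ * ‖iteratedFDeriv ℝ (j + 1) g x‖ := by
  have h : (⇑(∂_{v} g : SchwartzMap (EuclideanSpace ℝ (Fin n)) ℂ)) = fun y => fderiv ℝ g y v := by
    ext y
    exact SchwartzMap.lineDerivOp_apply_eq_fderiv v g y
  rw [h, ← norm_iteratedFDeriv_fderiv]
  exact norm_iteratedFDeriv_clm_apply_const (N := ∞)
    ((g.smooth ⊤).fderiv_right (by norm_num)).contDiffAt (natCast_le_infty j)

open LineDeriv in
/-- Multiplication of the Fourier transform by `|ξ|^(2k)` corresponds to a local operator. -/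
lemma exists_schwartz_fourier_eq_pow_mul (k : ℕ)
    (g : SchwartzMap (EuclideanSpace ℝ (Fin n)) ℂ) :
    ∃ h : SchwartzMap (EuclideanSpace ℝ (Fin n)) ℂ,
      (∀ ξ, (𝓕 h : SchwartzMap (EuclideanSpace ℝ (Fin n)) ℂ) ξ =
        (((2 * Real.pi * ‖ξ‖) ^ (2 * k) : ℝ) : ℂ) *
          (𝓕 g : SchwartzMap (EuclideanSpace ℝ (Fin n)) ℂ) ξ) ∧
      ∀ j x, ‖iteratedFDeriv ℝ j h x‖ ≤ n ^ k * ‖iteratedFDeriv ℝ (j + 2 * k) g x‖ := by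
  induction k with
  | zero => exact ⟨g, by simp, by simp⟩
  | succ k ih =>
    obtain ⟨h, h1, h2⟩ := ih
    let e : Fin n → EuclideanSpace ℝ (Fin n) := fun i => EuclideanSpace.single i 1
    have he : ∀ i, ‖e i‖ = 1 := fun i => by simp [e]
    -- The witness is `-Δ h`; its `n` second derivatives account for one more factor `n` in the
    -- bound.
    refine ⟨-∑ i, (∂_{e i} (∂_{e i} h)), fun ξ => ?_, fun j x => ?_⟩
    · let G : Fin n → SchwartzMap (EuclideanSpace ℝ (Fin n)) ℂ := fun i => ∂_{e i} (∂_{e i} h)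
      have hF : (𝓕 (-∑ i, G i) : SchwartzMap (EuclideanSpace ℝ (Fin n)) ℂ) =
          -∑ i, (𝓕 (G i) : SchwartzMap (EuclideanSpace ℝ (Fin n)) ℂ) := by
        rw [FourierTransform.fourier_neg, FourierTransform.fourier_sum]
      have hterm : ∀ i, (𝓕 (∂_{e i} (∂_{e i} h)) : SchwartzMap (EuclideanSpace ℝ (Fin n)) ℂ) ξ =
          -((2 * Real.pi) ^ 2 * (ξ i) ^ 2) *
            (𝓕 h : SchwartzMap (EuclideanSpace ℝ (Fin n)) ℂ) ξ := by
        intro i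
        have hg : (inner ℝ · (e i)).HasTemperateGrowth :=
          ((innerSL ℝ).flip (e i)).hasTemperateGrowth
        rw [SchwartzMap.fourier_lineDerivOp_eq, SchwartzMap.fourier_lineDerivOp_eq]
        simp only [smul_apply, SchwartzMap.smulLeftCLM_apply_apply hg]
        have hin : inner ℝ ξ (e i) = ξ i := by
          simp [e, EuclideanSpace.inner_single_right]
        rw [hin]
        simp only [smul_eq_mul, Complex.real_smul]
        linear_combination (4 * Real.pi ^ 2 * (ξ i) ^ 2 *
          (𝓕 h : SchwartzMap (EuclideanSpace ℝ (Fin n)) ℂ) ξ) * Complex.I_sq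
      change (𝓕 (-∑ i, G i) : SchwartzMap (EuclideanSpace ℝ (Fin n)) ℂ) ξ = _
      rw [hF]
      simp only [G, neg_apply, sum_apply, hterm]
      rw [← Finset.sum_mul, Finset.sum_neg_distrib, ← Finset.mul_sum, neg_mul, neg_neg, h1]
      have hnorm : (∑ i, ((ξ i : ℝ) : ℂ) ^ 2) = ((‖ξ‖ ^ 2 : ℝ) : ℂ) := by
        rw [EuclideanSpace.norm_sq_eq]
        push_cast
        refine Finset.sum_congr rfl fun i _ => ?_
        rw [Real.norm_eq_abs, ← Complex.ofReal_pow, ← Complex.ofReal_pow, sq_abs]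
      rw [hnorm]
      push_cast
      ring
    · have hco : ⇑(-∑ i, (∂_{e i} (∂_{e i} h))) =
          -fun y => ∑ i, (∂_{e i} (∂_{e i} h) : SchwartzMap (EuclideanSpace ℝ (Fin n)) ℂ) y := by
        ext y; simp
      rw [hco, iteratedFDeriv_neg_apply, norm_neg,
        iteratedFDeriv_sum (fun i _ => (SchwartzMap.smooth _ ⊤).of_le (natCast_le_infty j))]
      rw [Finset.sum_apply]
      refine (norm_sum_le _ _).trans ?_
      calc _ ≤ ∑ _i : Fin n, (n : ℝ) ^ k * ‖iteratedFDeriv ℝ (j + 2 * (k + 1)) g x‖ := by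
            refine Finset.sum_le_sum fun i _ => ?_
            have a1 := norm_iteratedFDeriv_lineDerivOp_le (∂_{e i} h) (e i) j x
            have a2 := norm_iteratedFDeriv_lineDerivOp_le h (e i) (j + 1) x
            have a3 := h2 (j + 1 + 1) x
            rw [he, one_mul] at a1 a2
            rw [show j + 1 + 1 + 2 * k = j + 2 * (k + 1) by ring] at a3
            exact a1.trans (a2.trans a3)
        _ = _ := by
            rw [Finset.sum_const, Finset.card_univ, Fintype.card_fin, nsmul_eq_mul]
            ring

/-- For integer order the fractional Laplacian is local. -/
lemma abs_fracLaplacian_natCast_le {f : EuclideanSpace ℝ (Fin n) → ℝ} (hf : ContDiff ℝ ∞ f)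
    (hc : HasCompactSupport f) (k : ℕ) (x : EuclideanSpace ℝ (Fin n)) :
    |fracLaplacian (k : ℝ) f x| ≤ n ^ k * ‖iteratedFDeriv ℝ (2 * k) f x‖ := by
  obtain ⟨h, h1, h2⟩ := exists_schwartz_fourier_eq_pow_mul k (schwartzOfReal hf hc)
  have e1 : fracLaplacian (k : ℝ) f x = (h x).re := by
    have h3 := congrArg (fun g : SchwartzMap (EuclideanSpace ℝ (Fin n)) ℂ => g x)
      (FourierTransform.fourierInv_fourier_eq
        (F := SchwartzMap (EuclideanSpace ℝ (Fin n)) ℂ) h)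
    simp only [SchwartzMap.fourierInv_coe] at h3
    have h4 : (fun ξ : EuclideanSpace ℝ (Fin n) =>
        (((2 * Real.pi * ‖ξ‖) ^ (2 * (k : ℝ)) : ℝ) : ℂ) * 𝓕 (fun y => (f y : ℂ)) ξ) =
        ⇑(𝓕 h : SchwartzMap (EuclideanSpace ℝ (Fin n)) ℂ) := by
      ext ξ
      rw [h1, fourier_ofReal_eq hf hc, ← Real.rpow_natCast]
      push_cast
      rfl
    rw [fracLaplacian, h4, h3]
  rw [e1]
  have h4 := h2 0 x
  rw [norm_iteratedFDeriv_zero, zero_add] at h4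
  refine (Complex.abs_re_le_norm _).trans (h4.trans ?_)
  gcongr
  have h5 := Complex.ofRealCLM.norm_iteratedFDeriv_comp_left (x := x) (N := ∞) (n := 2 * k)
    hf.contDiffAt (natCast_le_infty _)
  rw [Complex.ofRealCLM_norm, one_mul] at h5
  exact h5

end IntegerOrder

/-! ### Scaling, upper bounds and lower bounds for the fractional Laplacian. -/

section Estimates

variable {n : ℕ}

/-- Substitute `y ↦ a y` in the difference representation and use the homogeneity of the kernel. -/
lemma fracLaplacian_comp_smul (hn : n ≠ 0) {ρ : ℝ} (hρ : 0 < ρ)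
    {f : EuclideanSpace ℝ (Fin n) → ℝ} (hf : ContDiff ℝ ∞ f) (hc : HasCompactSupport f)
    {a : ℝ} (ha : 0 < a) (x : EuclideanSpace ℝ (Fin n)) :
    fracLaplacian ρ (fun y => f (a • y)) x = a ^ (2 * ρ) * fracLaplacian ρ f (a • x) := by
  obtain ⟨m, hm⟩ := exists_nat_gt ρ
  obtain ⟨c, hc0, hrep⟩ := exists_fracLaplacian_eq_integral hn hρ hm
  have hfa : ContDiff ℝ ∞ (fun y => f (a • y)) := hf.comp (contDiff_const_smul a)
  have hca : HasCompactSupport (fun y => f (a • y)) :=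
    hc.comp_homeomorph (Homeomorph.smulOfNeZero a ha.ne')
  have h1 := hrep _ hfa hca x
  have h2 := hrep _ hf hc (a • x)
  have h3 := Measure.integral_comp_smul (volume : Measure (EuclideanSpace ℝ (Fin n)))
    (fun y => symmDiffOp m f (a • x) y * rieszKernel ρ y) a
  have h4 : ∀ y : EuclideanSpace ℝ (Fin n),
      symmDiffOp m f (a • x) (a • y) * rieszKernel ρ (a • y) =
      a ^ (-((Module.finrank ℝ (EuclideanSpace ℝ (Fin n)) : ℝ) + 2 * ρ)) *
        (symmDiffOp m (fun y => f (a • y)) x y * rieszKernel ρ y) := by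
    intro y
    rw [rieszKernel_smul ha]
    have : symmDiffOp m f (a • x) (a • y) = symmDiffOp m (fun y => f (a • y)) x y := by
      simp only [symmDiffOp, smul_add]
      simp_rw [smul_comm a]
    rw [this]; ring
  simp_rw [h4] at h3
  rw [integral_const_mul, smul_eq_mul, abs_of_pos (by positivity), ← h1, ← h2] at h3
  set d : ℝ := (Module.finrank ℝ (EuclideanSpace ℝ (Fin n)) : ℝ)
  have e1 : (a ^ Module.finrank ℝ (EuclideanSpace ℝ (Fin n)))⁻¹ = a ^ (-d) := by
    rw [Real.rpow_neg ha.le, Real.rpow_natCast]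
  have e2 : a ^ (-(d + 2 * ρ)) = a ^ (-d) * (a ^ (2 * ρ))⁻¹ := by
    rw [neg_add, Real.rpow_add ha, Real.rpow_neg ha.le (2 * ρ)]
  rw [e1, e2, mul_assoc] at h3
  have h5 := mul_left_cancel₀ (Real.rpow_pos_of_pos ha _).ne' h3
  rw [inv_mul_eq_iff_eq_mul₀ (Real.rpow_pos_of_pos ha _).ne'] at h5
  apply mul_left_cancel₀ hc0.ne'
  linarith

lemma fracLaplacian_const_mul (hn : n ≠ 0) {ρ : ℝ} (hρ : 0 < ρ)
    {f : EuclideanSpace ℝ (Fin n) → ℝ} (hf : ContDiff ℝ ∞ f) (hc : HasCompactSupport f)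
    (a : ℝ) (x : EuclideanSpace ℝ (Fin n)) :
    fracLaplacian ρ (fun y => a * f y) x = a * fracLaplacian ρ f x := by
  obtain ⟨m, hm⟩ := exists_nat_gt ρ
  obtain ⟨c, hc0, hrep⟩ := exists_fracLaplacian_eq_integral hn hρ hm
  have h1 := hrep _ (contDiff_const.mul hf) (hc.mul_left (f := fun _ => a)) x
  have h2 := hrep _ hf hc x
  have h4 : ∀ y, symmDiffOp m (fun y => a * f y) x y = a * symmDiffOp m f x y := by
    intro y
    simp only [symmDiffOp, Finset.mul_sum]
    exact Finset.sum_congr rfl fun j _ => by ring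
  simp_rw [h4, mul_assoc] at h1
  rw [integral_const_mul, ← h2] at h1
  apply mul_left_cancel₀ hc0.ne'
  linarith

variable {E : Type*} [NormedAddCommGroup E] [InnerProductSpace ℝ E] [FiniteDimensional ℝ E]
  [MeasurableSpace E] [BorelSpace E]

lemma integrable_bracketWeight {b : ℝ} (hb : (Module.finrank ℝ E : ℝ) < b) :
    Integrable (bracketWeight b : E → ℝ) :=
  integrable_rpow_neg_one_add_norm_sq hb

/-- Convolution-type estimate for the weight with itself. -/
lemma integral_bracketWeight_mul_le {b : ℝ} (hb : (Module.finrank ℝ E : ℝ) < b) {l L : ℝ}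
    (hl : l = 0 ∨ 1 ≤ |l|) (hL : 1 ≤ L) (hlL : |l| ≤ L) (x : E) :
    Integrable (fun y : E => bracketWeight b (x + l • y) * bracketWeight b y) ∧
    ∫ y : E, bracketWeight b (x + l • y) * bracketWeight b y ≤
      (L ^ b * 2 ^ b * 2 * ∫ y : E, bracketWeight b y) * bracketWeight b x := by
  have hb0 : 0 ≤ b := (Nat.cast_nonneg _).trans hb.le
  have hI := integrable_bracketWeight hb
  have hint : Integrable (fun y : E => bracketWeight b (x + l • y) * bracketWeight b y) := by
    refine hI.bdd_mul (c := 1) ?_ (Filter.Eventually.of_forall fun y => ?_)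
    · exact ((continuous_bracketWeight b).comp (by fun_prop)).aestronglyMeasurable
    · rw [Real.norm_eq_abs, abs_of_pos (bracketWeight_pos b _)]
      exact bracketWeight_le_one hb0 _
  refine ⟨hint, ?_⟩
  set W := ∫ y : E, bracketWeight b y with hW
  have hW0 : 0 ≤ W := integral_nonneg fun y => (bracketWeight_pos b y).le
  have hx := (bracketWeight_pos b x).le
  have hLb : 1 ≤ L ^ b := Real.one_le_rpow hL hb0
  have h2b : (1 : ℝ) ≤ 2 ^ b := Real.one_le_rpow (by norm_num) hb0
  rcases hl with rfl | hl
  · simp only [zero_smul, add_zero]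
    rw [integral_const_mul, ← hW, mul_comm]
    gcongr
    have h1 : 1 * 1 ≤ L ^ b * 2 ^ b := by gcongr
    nlinarith
  · have hl0 : l ≠ 0 := by
      rintro rfl; simp at hl; linarith
    have hIl : Integrable (fun y : E => bracketWeight b (l • y)) := hI.comp_smul hl0
    have hIl' : Integrable (fun y : E => bracketWeight b (x + l • y)) := by
      have h1 := hI.comp_add_left x
      exact h1.comp_smul (f := fun z => bracketWeight b (x + z)) hl0
    -- The multiples `l` that occur are integers, so a nonzero one satisfies `|l| ≥ 1` and the
    -- Jacobian of the substitution is at most `1`.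
    have hfac : |(l ^ Module.finrank ℝ E)⁻¹| ≤ 1 := by
      rw [abs_inv, abs_pow]
      exact inv_le_one_of_one_le₀ (one_le_pow₀ hl)
    have i1 : ∫ y : E, bracketWeight b (l • y) ≤ W := by
      rw [Measure.integral_comp_smul, smul_eq_mul]
      exact mul_le_of_le_one_left hW0 hfac
    have i2 : ∫ y : E, bracketWeight b (x + l • y) ≤ W := by
      rw [Measure.integral_comp_smul volume (fun z => bracketWeight b (x + z)) l, smul_eq_mul,
        integral_add_left_eq_self (fun z : E => bracketWeight b z) x]
      exact mul_le_of_le_one_left hW0 hfac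
    have hpt : ∀ y : E, bracketWeight b (x + l • y) * bracketWeight b y ≤
        (L ^ b * 2 ^ b * bracketWeight b x) *
          (bracketWeight b (x + l • y) + bracketWeight b (l • y)) := by
      intro y
      have h1 : bracketWeight b y ≤ L ^ b * bracketWeight b (l • y) := by
        apply bracketWeight_le_mul hb0 (by linarith)
        rw [norm_smul, mul_pow, Real.norm_eq_abs]
        have h3 : |l| ^ 2 ≤ L ^ 2 := by gcongr
        have h4 : 1 ≤ L ^ 2 := one_le_pow₀ hL
        nlinarith [sq_nonneg ‖y‖, mul_le_mul_of_nonneg_right h3 (sq_nonneg ‖y‖)]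
      have h2 := bracketWeight_mul_le hb0 x (l • y)
      calc _ ≤ bracketWeight b (x + l • y) * (L ^ b * bracketWeight b (l • y)) := by
            gcongr
            exact (bracketWeight_pos b _).le
        _ = L ^ b * (bracketWeight b (x + l • y) * bracketWeight b (l • y)) := by ring
        _ ≤ L ^ b * (2 ^ b * bracketWeight b x *
          (bracketWeight b (x + l • y) + bracketWeight b (l • y))) := by gcongr
        _ = _ := by ring
    calc _ ≤ ∫ y : E, (L ^ b * 2 ^ b * bracketWeight b x) *
          (bracketWeight b (x + l • y) + bracketWeight b (l • y)) :=
          integral_mono hint ((hIl'.add hIl).const_mul _) hpt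
      _ = (L ^ b * 2 ^ b * bracketWeight b x) *
          ((∫ y : E, bracketWeight b (x + l • y)) + ∫ y : E, bracketWeight b (l • y)) := by
          rw [integral_const_mul, integral_add hIl' hIl]
      _ ≤ (L ^ b * 2 ^ b * bracketWeight b x) * (W + W) := by gcongr
      _ = _ := by ring

/-- Off the unit ball `1 + ‖y‖² ≤ 4 ‖y‖²`. The condition `b ≤ d + 2ρ` enters here: the weight may
not decay faster than the kernel. -/
lemma rieszKernel_le_bracketWeight {b ρ : ℝ} (hb : 0 ≤ b)
    (hbρ : b ≤ (Module.finrank ℝ E : ℝ) + 2 * ρ) {y : E} (hy : 1 ≤ ‖y‖) :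
    rieszKernel ρ y ≤ 2 ^ b * bracketWeight b y := by
  have h1 : rieszKernel ρ y ≤ ‖y‖ ^ (-b) :=
    Real.rpow_le_rpow_of_exponent_le hy (by linarith)
  have h2 : ‖y‖ ^ (-b) = (‖y‖ ^ 2) ^ (-b / 2) := by
    rw [← Real.rpow_natCast, ← Real.rpow_mul (norm_nonneg y)]
    congr 1; push_cast; ring
  have h3 : (4 * ‖y‖ ^ 2) ^ (-b / 2) ≤ (1 + ‖y‖ ^ 2) ^ (-b / 2) :=
    Real.rpow_le_rpow_of_nonpos (by positivity) (by nlinarith) (by linarith)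
  have h4 : (4 : ℝ) ^ (-b / 2) = (2 ^ b)⁻¹ := by
    rw [show (4 : ℝ) = 2 ^ (2 : ℝ) by norm_num, ← Real.rpow_mul (by norm_num),
      ← Real.rpow_neg (by norm_num)]
    congr 1; ring
  rw [Real.mul_rpow (by norm_num) (by positivity), h4, inv_mul_le_iff₀ (by positivity)] at h3
  rw [h2] at h1
  exact h1.trans h3

lemma natCast_sub_natCast_eq_zero_or (j m : ℕ) : (j : ℝ) - m = 0 ∨ 1 ≤ |(j : ℝ) - m| := by
  by_cases h : j = m
  · left; simp [h]
  · right
    have : (1 : ℤ) ≤ |(j : ℤ) - m| := Int.one_le_abs (by omega)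
    exact_mod_cast this

/-- Decay of the fractional Laplacian of decaying test functions. -/
lemma exists_abs_fracLaplacian_le (hn : n ≠ 0) {ρ b : ℝ} (hρ : 0 < ρ) (hb : (n : ℝ) < b)
    (hbρ : b ≤ n + 2 * ρ) {m : ℕ} (hm : ρ < m) :
    ∃ C, 0 ≤ C ∧ ∀ f : EuclideanSpace ℝ (Fin n) → ℝ, ContDiff ℝ ∞ f → HasCompactSupport f →
      ∀ B, 0 ≤ B → (∀ x, |f x| ≤ B * bracketWeight b x) →
      (∀ x, ‖iteratedFDeriv ℝ (2 * m) f x‖ ≤ B * bracketWeight b x) →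
      ∀ x, |fracLaplacian ρ f x| ≤ C * B * bracketWeight b x := by
  have : Nonempty (Fin n) := Fin.pos_iff_nonempty.1 (Nat.pos_of_ne_zero hn)
  have hd : Module.finrank ℝ (EuclideanSpace ℝ (Fin n)) = n := by simp
  have hb0 : 0 ≤ b := (Nat.cast_nonneg _).trans hb.le
  have hm1 : (1 : ℝ) ≤ m := by
    have : (0 : ℝ) < m := by linarith
    exact_mod_cast this
  obtain ⟨c, hc0, hrep⟩ := exists_fracLaplacian_eq_integral hn hρ hm
  set K := ∫ y : EuclideanSpace ℝ (Fin n), min 1 (‖y‖ ^ (2 * m)) * rieszKernel ρ y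
  have hKi := integrable_min_mul_rieszKernel (E := EuclideanSpace ℝ (Fin n)) hρ hm
  have hκ0 : ∀ y : EuclideanSpace ℝ (Fin n), 0 ≤ min 1 (‖y‖ ^ (2 * m)) * rieszKernel ρ y :=
    fun y => mul_nonneg (le_min zero_le_one (by positivity)) (rieszKernel_nonneg ρ y)
  have hK0 : 0 ≤ K := integral_nonneg hκ0
  set W := ∫ y : EuclideanSpace ℝ (Fin n), bracketWeight b y
  have hW0 : 0 ≤ W := integral_nonneg fun y => (bracketWeight_pos b y).le
  set D := (m : ℝ) ^ b * 2 ^ b * 2 * W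
  have hD0 : 0 ≤ D := by positivity
  refine ⟨c⁻¹ * ((2 * m) ^ b * K + 2 ^ b * ∑ j ∈ Finset.range (2 * m + 1),
    ((2 * m).choose j : ℝ) * D), by positivity, fun f hf hfc B hB hf0 hf2 x => ?_⟩
  have hwx := (bracketWeight_pos b x).le
  set T : ℕ → EuclideanSpace ℝ (Fin n) → ℝ := fun j y =>
    bracketWeight b (x + ((j : ℝ) - m) • y) * bracketWeight b y
  have hT0 : ∀ j y, 0 ≤ T j y := fun j y =>
    mul_nonneg (bracketWeight_pos b _).le (bracketWeight_pos b _).le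
  have hTj : ∀ j ∈ Finset.range (2 * m + 1), Integrable (T j) ∧
      ∫ y, T j y ≤ D * bracketWeight b x := by
    intro j hj
    have hj' : j ≤ 2 * m := by simpa [Nat.lt_succ_iff] using hj
    refine integral_bracketWeight_mul_le (by rw [hd]; exact hb)
      (natCast_sub_natCast_eq_zero_or j m) hm1 ?_ x
    have : (j : ℝ) ≤ 2 * m := by exact_mod_cast hj'
    rw [abs_le]; constructor <;> linarith [(Nat.cast_nonneg j : (0 : ℝ) ≤ j)]
  -- The first summand dominates for `‖y‖ ≤ 1`, through the derivatives of order `2m` near `x`; the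
  -- second for `‖y‖ ≥ 1`, node by node, through the convolution estimate for the weight.
  set bound : EuclideanSpace ℝ (Fin n) → ℝ := fun y =>
    B * bracketWeight b x * (2 * m) ^ b * (min 1 (‖y‖ ^ (2 * m)) * rieszKernel ρ y) +
      ∑ j ∈ Finset.range (2 * m + 1), B * 2 ^ b * ((2 * m).choose j : ℝ) * T j y
  have hbi1 : Integrable (fun y : EuclideanSpace ℝ (Fin n) =>
      B * bracketWeight b x * (2 * m) ^ b * (min 1 (‖y‖ ^ (2 * m)) * rieszKernel ρ y)) :=
    hKi.const_mul _
  have hbi2 : Integrable (fun y : EuclideanSpace ℝ (Fin n) =>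
      ∑ j ∈ Finset.range (2 * m + 1), B * 2 ^ b * ((2 * m).choose j : ℝ) * T j y) :=
    integrable_finsetSum _ fun j hj => (hTj j hj).1.const_mul _
  have hpt : ∀ y, ‖symmDiffOp m f x y * rieszKernel ρ y‖ ≤ bound y := by
    intro y
    have hR := rieszKernel_nonneg ρ y
    have hsum0 : 0 ≤ ∑ j ∈ Finset.range (2 * m + 1), B * 2 ^ b * ((2 * m).choose j : ℝ) * T j y :=
      Finset.sum_nonneg fun j _ => mul_nonneg (by positivity) (hT0 j y)
    rw [norm_mul, Real.norm_eq_abs, Real.norm_eq_abs, abs_of_nonneg hR]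
    rcases le_total ‖y‖ 1 with hy | hy
    · have h1 := abs_symmDiffOp_le (m := m) (x := x) (M := B * ((2 * m) ^ b * bracketWeight b x))
        hf hy (fun z hz => (hf2 z).trans (by
          gcongr
          exact bracketWeight_le_shift hb0 hm1 (by rwa [norm_sub_rev])))
      have h2 : min 1 (‖y‖ ^ (2 * m)) = ‖y‖ ^ (2 * m) :=
        min_eq_right (pow_le_one₀ (norm_nonneg _) hy)
      calc _ ≤ B * ((2 * m) ^ b * bracketWeight b x) * ‖y‖ ^ (2 * m) * rieszKernel ρ y := by
            gcongr
        _ = B * bracketWeight b x * (2 * m) ^ b *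
            (min 1 (‖y‖ ^ (2 * m)) * rieszKernel ρ y) := by rw [h2]; ring
        _ ≤ _ := le_add_of_nonneg_right hsum0
    · have h1 := abs_symmDiffOp_le_sum m f x y
      have h2 := rieszKernel_le_bracketWeight (ρ := ρ) hb0 (by rw [hd]; exact hbρ) hy
      calc _ ≤ (∑ j ∈ Finset.range (2 * m + 1),
            ((2 * m).choose j : ℝ) * |f (x + ((j : ℝ) - m) • y)|) *
              (2 ^ b * bracketWeight b y) := by gcongr
        _ ≤ ∑ j ∈ Finset.range (2 * m + 1), B * 2 ^ b * ((2 * m).choose j : ℝ) * T j y := by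
            rw [Finset.sum_mul]
            refine Finset.sum_le_sum fun j _ => ?_
            have h3 := hf0 (x + ((j : ℝ) - m) • y)
            have h4 := (bracketWeight_pos b y).le
            calc _ ≤ ((2 * m).choose j : ℝ) * (B * bracketWeight b (x + ((j : ℝ) - m) • y)) *
                  (2 ^ b * bracketWeight b y) := by gcongr
              _ = _ := by simp only [T]; ring
        _ ≤ _ := le_add_of_nonneg_left (mul_nonneg (by positivity) (hκ0 y))
  have hmain : |∫ y, symmDiffOp m f x y * rieszKernel ρ y| ≤ ∫ y, bound y :=
    norm_integral_le_of_norm_le (hbi1.add hbi2) (Filter.Eventually.of_forall hpt)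
  have hbound : ∫ y, bound y ≤ B * bracketWeight b x * ((2 * m) ^ b * K +
      2 ^ b * ∑ j ∈ Finset.range (2 * m + 1), ((2 * m).choose j : ℝ) * D) := by
    rw [integral_add hbi1 hbi2, integral_const_mul,
      integral_finsetSum _ fun j hj => (hTj j hj).1.const_mul _, mul_add]
    refine add_le_add (le_of_eq (by ring)) ?_
    rw [Finset.mul_sum, Finset.mul_sum]
    refine Finset.sum_le_sum fun j hj => ?_
    rw [integral_const_mul]
    calc _ ≤ B * 2 ^ b * ((2 * m).choose j : ℝ) * (D * bracketWeight b x) := by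
          gcongr
          exact (hTj j hj).2
      _ = _ := by ring
  rw [← hrep f hf hfc x, abs_mul, abs_of_pos hc0] at hmain
  have h5 := hmain.trans hbound
  rw [mul_comm c, ← le_div_iff₀ hc0] at h5
  refine h5.trans (le_of_eq ?_)
  rw [div_eq_inv_mul]
  ring

/-- Lower bound for the fractional Laplacian of a bump at infinity for non-integer order. -/
lemma exists_le_abs_fracLaplacian (hn : n ≠ 0) {ρ : ℝ} (hρ : 0 < ρ) (hint : ∀ k : ℕ, ρ ≠ k)
    {f : EuclideanSpace ℝ (Fin n) → ℝ} (hf : ContDiff ℝ ∞ f) (hfc : HasCompactSupport f)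
    (hf0 : ∀ x, 0 ≤ f x) (hf1 : ∀ x, 1 ≤ ‖x‖ → f x = 0) (hfI : 0 < ∫ x, f x) :
    ∃ c > 0, ∀ x, 2 ≤ ‖x‖ →
      c * bracketWeight (n + 2 * ρ) x ≤ |fracLaplacian ρ f x| := by
  obtain ⟨m, hm⟩ := exists_nat_gt ρ
  obtain ⟨c, hc0, hrep⟩ := exists_fracLaplacian_eq_integral hn hρ hm
  have hd : (Module.finrank ℝ (EuclideanSpace ℝ (Fin n)) : ℝ) = n := by simp
  have hA := diffCoeff_ne_zero hρ hm hint
  set q : ℝ := n + 2 * ρ with hq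
  have hq0 : 0 < q := by positivity
  refine ⟨|diffCoeff m ρ| * 2 ^ (-q) * (∫ x, f x) / c, by positivity, fun x hx => ?_⟩
  set g : EuclideanSpace ℝ (Fin n) → ℝ := fun z => f (x + z) * rieszKernel ρ z
  have hgi : Integrable g := by
    have h1 : Integrable fun z => f (x + z) :=
      (hf.continuous.integrable_of_hasCompactSupport hfc).comp_add_left x
    refine h1.mono ?_ (Filter.Eventually.of_forall fun z => ?_)
    · exact h1.aestronglyMeasurable.mul (measurable_rieszKernel ρ).aestronglyMeasurable
    · by_cases hz : 1 ≤ ‖x + z‖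
      · simp [g, hf1 _ hz]
      · have h2 : 1 ≤ ‖z‖ := by
          have := norm_sub_le (x + z) z
          simp only [add_sub_cancel_right] at this
          linarith
        simp only [g, norm_mul]
        refine mul_le_of_le_one_right (norm_nonneg _) ?_
        rw [Real.norm_eq_abs, abs_of_nonneg (rieszKernel_nonneg ρ z)]
        exact Real.rpow_le_one_of_one_le_of_nonpos h2 (by rw [hd]; linarith)
  -- Substituting `z = (j - m) y` turns every node into the same integral, with factor `|j -
  -- m|^(2ρ)`. The node `j = m` contributes zero because `f x = 0`. The sum over the nodes therefore
  -- factors as `diffCoeff m ρ` times `∫ g`.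
  have hterm : ∀ j : ℕ, Integrable (fun y => f (x + ((j : ℝ) - m) • y) * rieszKernel ρ y) ∧
      ∫ y, f (x + ((j : ℝ) - m) • y) * rieszKernel ρ y =
        |(j : ℝ) - m| ^ (2 * ρ) * ∫ z, g z := by
    intro j
    by_cases hjm : (j : ℝ) - m = 0
    · rw [hjm]
      simp [hf1 x (by linarith), Real.zero_rpow (by linarith : 2 * ρ ≠ 0)]
    · set l : ℝ := (j : ℝ) - m
      have hl : 0 < |l| := abs_pos.2 hjm
      have hK : ∀ y : EuclideanSpace ℝ (Fin n), f (x + l • y) * rieszKernel ρ y =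
          |l| ^ q * g (l • y) := by
        intro y
        simp only [g, rieszKernel, hd, ← hq]
        rw [norm_smul, Real.norm_eq_abs, Real.mul_rpow hl.le (norm_nonneg _),
          Real.rpow_neg hl.le]
        field_simp
      simp_rw [hK]
      refine ⟨(hgi.comp_smul hjm).const_mul _, ?_⟩
      rw [integral_const_mul, Measure.integral_comp_smul, smul_eq_mul, ← mul_assoc]
      congr 1
      rw [abs_inv, abs_pow, ← Real.rpow_natCast, hd, ← Real.rpow_neg hl.le, ← Real.rpow_add hl]
      congr 1
      rw [hq]; ring
  have hsum : ∫ y, symmDiffOp m f x y * rieszKernel ρ y = diffCoeff m ρ * ∫ z, g z := by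
    have e : ∀ y, symmDiffOp m f x y * rieszKernel ρ y = ∑ j ∈ Finset.range (2 * m + 1),
        (-1) ^ (m + j) * ((2 * m).choose j : ℝ) *
          (f (x + ((j : ℝ) - m) • y) * rieszKernel ρ y) := by
      intro y
      rw [symmDiffOp, Finset.sum_mul]
      exact Finset.sum_congr rfl fun j _ => by ring
    simp_rw [e]
    rw [integral_finsetSum _ fun j _ => (hterm j).1.const_mul _, diffCoeff, Finset.sum_mul]
    refine Finset.sum_congr rfl fun j _ => ?_
    rw [integral_const_mul, (hterm j).2]
    ring
  -- Where `f (x + z) ≠ 0` one has `‖x + z‖ < 1`, hence `0 < ‖z‖ ≤ 2 ‖x‖`, which bounds the kernel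
  -- below.
  have hlow : 2 ^ (-q) * bracketWeight q x * ∫ x, f x ≤ ∫ z, g z := by
    rw [← integral_add_left_eq_self f x, ← integral_const_mul]
    refine integral_mono
      (((hf.continuous.integrable_of_hasCompactSupport hfc).comp_add_left x).const_mul _) hgi
      fun z => ?_
    by_cases hz : 1 ≤ ‖x + z‖
    · simp [g, hf1 _ hz]
    · simp only [g]
      rw [mul_comm]
      refine mul_le_mul_of_nonneg_left ?_ (hf0 _)
      have hz1 : ‖z‖ ≤ 2 * ‖x‖ := by
        have := norm_sub_le (x + z) x
        simp only [add_sub_cancel_left] at this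
        linarith
      have hz0 : 0 < ‖z‖ := by
        have := norm_sub_le (x + z) z
        simp only [add_sub_cancel_right] at this
        linarith
      have hx0 : 0 < ‖x‖ := by linarith
      have h1 : (2 * ‖x‖) ^ (-q) ≤ ‖z‖ ^ (-q) :=
        Real.rpow_le_rpow_of_nonpos hz0 hz1 (by linarith)
      have h2 : bracketWeight q x ≤ ‖x‖ ^ (-q) := by
        have h3 : ‖x‖ ^ (-q) = (‖x‖ ^ 2) ^ (-q / 2) := by
          rw [← Real.rpow_natCast, ← Real.rpow_mul hx0.le]
          congr 1; push_cast; ring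
        rw [h3]
        exact Real.rpow_le_rpow_of_nonpos (by positivity) (by linarith) (by linarith)
      rw [Real.mul_rpow (by norm_num) hx0.le] at h1
      simp only [rieszKernel, hd, ← hq]
      exact (mul_le_mul_of_nonneg_left h2 (by positivity)).trans h1
  have hfin : c * |fracLaplacian ρ f x| = |diffCoeff m ρ| * ∫ z, g z := by
    rw [← abs_of_pos hc0, ← abs_mul, hrep f hf hfc x, hsum, abs_mul]
    congr 1
    exact abs_of_nonneg (integral_nonneg fun z => mul_nonneg (hf0 _) (rieszKernel_nonneg ρ z))
  have h6 := mul_le_mul_of_nonneg_left hlow (abs_nonneg (diffCoeff m ρ))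
  rw [← hfin, mul_comm c, ← div_le_iff₀ hc0] at h6
  refine le_trans (le_of_eq ?_) h6
  ring

end Estimates

/-! ### Cutoffs whose derivatives are controlled by their own `1/p`-th power. -/

section Cutoffs

/-- Any `M > j p / (p - 1)` works. The inequality is chosen so that `χ ^ (M - j) ≤ (χ ^ M)^(1/p)`
for `0 ≤ χ ≤ 1`. -/
lemma exists_nat_pow_exponent (j : ℕ) {p : ℝ} (hp : 1 < p) :
    ∃ M : ℕ, j < M ∧ (M : ℝ) / p ≤ M - j := by
  obtain ⟨M, hM⟩ := exists_nat_gt (j * p / (p - 1))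
  have hp1 : 0 < p - 1 := by linarith
  rw [div_lt_iff₀ hp1] at hM
  refine ⟨M, ?_, ?_⟩
  · have h : (j : ℝ) < M := by
      by_contra h
      push Not at h
      have h1 : (M : ℝ) * (p - 1) ≤ j * (p - 1) := by gcongr
      have h2 : (0 : ℝ) ≤ M := Nat.cast_nonneg _
      have h3 : (0 : ℝ) ≤ j := Nat.cast_nonneg _
      nlinarith
    exact_mod_cast h
  · rw [div_le_iff₀ (by linarith)]
    linarith

lemma pow_sub_le_rpow {x p : ℝ} (h0 : 0 ≤ x) (h1 : x ≤ 1) (hp : 1 < p) {M j : ℕ} (hj : j < M)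
    (hM : (M : ℝ) / p ≤ M - j) : x ^ (M - j) ≤ (x ^ M) ^ (1 / p) := by
  rw [← Real.rpow_natCast x M, ← Real.rpow_mul h0, ← Real.rpow_natCast, Nat.cast_sub hj.le]
  refine Real.rpow_le_rpow_of_exponent_ge' h0 h1 (by positivity) ?_
  rw [mul_one_div]
  exact hM

/-- A spatial or temporal cutoff all of whose derivatives up to a given order are controlled by its
`1/p`-th power. -/
lemma exists_cutoff {E : Type*} [NormedAddCommGroup E] [InnerProductSpace ℝ E]
    [FiniteDimensional ℝ E] (j : ℕ) {p : ℝ} (hp : 1 < p) :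
    ∃ η : E → ℝ, ContDiff ℝ ∞ η ∧ HasCompactSupport η ∧ (∀ x, 0 ≤ η x) ∧ (∀ x, η x ≤ 1) ∧
      η 0 = 1 ∧ (∀ x, 2 ≤ ‖x‖ → η x = 0) ∧ ∃ C, 0 ≤ C ∧ ∀ i ≤ j, ∀ x,
        ‖iteratedFDeriv ℝ i η x‖ ≤ C * η x ^ (1 / p) := by
  let χ : ContDiffBump (0 : E) := ⟨1, 2, one_pos, one_lt_two⟩
  obtain ⟨M, hj, hM⟩ := exists_nat_pow_exponent j hp
  have hM0 : M ≠ 0 := by omega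
  obtain ⟨C, hC0, hC⟩ := exists_norm_iteratedFDeriv_pow_le (χ := χ) χ.contDiff
    χ.hasCompactSupport (fun x => χ.nonneg) (fun x => χ.le_one) M j
  refine ⟨fun x => χ x ^ M, χ.contDiff.pow M, ?_, fun x => pow_nonneg χ.nonneg _,
    fun x => pow_le_one₀ χ.nonneg χ.le_one, ?_, fun x hx => ?_, C, hC0, fun i hi x => ?_⟩
  · exact χ.hasCompactSupport.comp_left (g := fun t : ℝ => t ^ M) (zero_pow hM0)
  · have : χ 0 = 1 := χ.one_of_mem_closedBall (by simp [χ])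
    simp [this]
  · have : χ x = 0 := χ.zero_of_le_dist (by simpa [χ] using hx)
    simp [this, hM0]
  · exact (hC i hi x).trans (mul_le_mul_of_nonneg_left
      (pow_sub_le_rpow χ.nonneg χ.le_one hp hj hM) hC0)

end Cutoffs

/-! ### Passage to the limit in the truncation. -/

section Limits

/-- Fatou's lemma for nonnegative real functions with convergent bounds. -/
lemma integrable_and_integral_le_of_tendsto {α : Type*} [MeasurableSpace α] {μ : Measure α}
    {F : ℕ → α → ℝ} {G : α → ℝ} {B : ℕ → ℝ} {b : ℝ} (hF : ∀ k, Integrable (F k) μ)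
    (hF0 : ∀ k x, 0 ≤ F k x) (hlim : ∀ x, Filter.Tendsto (fun k => F k x) Filter.atTop (nhds (G x)))
    (hB : ∀ k, ∫ x, F k x ∂μ ≤ B k) (hb : Filter.Tendsto B Filter.atTop (nhds b)) :
    Integrable G μ ∧ ∫ x, G x ∂μ ≤ b := by
  have hG0 : ∀ x, 0 ≤ G x := fun x => ge_of_tendsto' (hlim x) (fun k => hF0 k x)
  have hGm : AEStronglyMeasurable G μ := aestronglyMeasurable_of_tendsto_ae Filter.atTop
    (fun k => (hF k).aestronglyMeasurable) (Filter.Eventually.of_forall hlim)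
  have hb0 : 0 ≤ b := ge_of_tendsto' hb fun k => (integral_nonneg (hF0 k)).trans (hB k)
  have key : ∫⁻ x, ENNReal.ofReal (G x) ∂μ ≤ ENNReal.ofReal b := by
    have h1 : ∀ x, ENNReal.ofReal (G x) =
        Filter.liminf (fun k => ENNReal.ofReal (F k x)) Filter.atTop := fun x =>
      ((ENNReal.tendsto_ofReal (hlim x)).liminf_eq).symm
    simp_rw [h1]
    refine (lintegral_liminf_le' fun k =>
      (hF k).aestronglyMeasurable.aemeasurable.ennreal_ofReal).trans ?_
    rw [← (ENNReal.tendsto_ofReal hb).liminf_eq]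
    refine Filter.liminf_le_liminf (Filter.Eventually.of_forall fun k => ?_)
    rw [← ofReal_integral_eq_lintegral_ofReal (hF k) (Filter.Eventually.of_forall (hF0 k))]
    exact ENNReal.ofReal_le_ofReal (hB k)
  have hGi : Integrable G μ := by
    refine ⟨hGm, ?_⟩
    rw [hasFiniteIntegral_iff_ofReal (Filter.Eventually.of_forall hG0)]
    exact key.trans_lt ENNReal.ofReal_lt_top
  refine ⟨hGi, ?_⟩
  rw [← ofReal_integral_eq_lintegral_ofReal hGi (Filter.Eventually.of_forall hG0)] at key
  exact (ENNReal.ofReal_le_ofReal_iff hb0).1 key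

end Limits

/-! ### Separated, rescaled test functions. -/

section TestFunctions

variable {n : ℕ}

/-- Separated test function, rescaled in time by `τ` and in space by `a`. -/
def scaledProduct (η : ℝ → ℝ) (f : EuclideanSpace ℝ (Fin n) → ℝ) (τ a : ℝ) :
    ℝ × EuclideanSpace ℝ (Fin n) → ℝ := fun z => η (τ * z.1) * f (a • z.2)

lemma isTestFunction_scaledProduct {η : ℝ → ℝ} {f : EuclideanSpace ℝ (Fin n) → ℝ}
    (hη : ContDiff ℝ ∞ η) (hηc : HasCompactSupport η) (hf : ContDiff ℝ ∞ f)
    (hfc : HasCompactSupport f) {τ a : ℝ} (hτ : τ ≠ 0) (ha : a ≠ 0) :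
    IsTestFunction (scaledProduct η f τ a) := by
  constructor
  · exact (hη.comp (contDiff_const.mul contDiff_fst)).mul
      (hf.comp (contDiff_snd.const_smul a))
  · have h1 : HasCompactSupport (fun t => η (τ * t)) :=
      hηc.comp_homeomorph (Homeomorph.mulLeft₀ τ hτ)
    have h2 : HasCompactSupport (fun x => f (a • x)) :=
      hfc.comp_homeomorph (Homeomorph.smulOfNeZero a ha)
    refine HasCompactSupport.of_support_subset_isCompact (h1.isCompact.prod h2.isCompact) ?_
    intro z hz
    have hz' : η (τ * z.1) * f (a • z.2) ≠ 0 := hz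
    exact ⟨subset_tsupport _ (left_ne_zero_of_mul hz'), subset_tsupport _ (right_ne_zero_of_mul hz')⟩

lemma timeDeriv_scaledProduct {η : ℝ → ℝ} (hη : ContDiff ℝ ∞ η)
    (f : EuclideanSpace ℝ (Fin n) → ℝ) (τ a : ℝ) :
    timeDeriv (scaledProduct η f τ a) = scaledProduct (fun t => τ * deriv η t) f τ a := by
  ext z
  have h1 : HasDerivAt η (deriv η (τ * z.1)) (τ * z.1) :=
    (hη.differentiable (by norm_num)).differentiableAt.hasDerivAt
  have h2 : HasDerivAt (fun t => η (τ * t)) (deriv η (τ * z.1) * τ) z.1 := by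
    have := h1.comp z.1 ((hasDerivAt_id z.1).const_mul τ)
    simpa [Function.comp_def] using this
  have h3 := (h2.mul_const (f (a • z.2))).deriv
  rw [timeDeriv]
  simp only [scaledProduct]
  rw [h3]
  ring

lemma spaceFracLaplacian_scaledProduct (hn : n ≠ 0) {ρ : ℝ} (hρ : 0 < ρ) (η : ℝ → ℝ)
    {f : EuclideanSpace ℝ (Fin n) → ℝ} (hf : ContDiff ℝ ∞ f) (hfc : HasCompactSupport f)
    (τ : ℝ) {a : ℝ} (ha : 0 < a) (z : ℝ × EuclideanSpace ℝ (Fin n)) :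
    spaceFracLaplacian ρ (scaledProduct η f τ a) z =
      η (τ * z.1) * (a ^ (2 * ρ) * fracLaplacian ρ f (a • z.2)) := by
  have hfa : ContDiff ℝ ∞ (fun y => f (a • y)) := hf.comp (contDiff_const_smul a)
  have hca : HasCompactSupport (fun y => f (a • y)) :=
    hfc.comp_homeomorph (Homeomorph.smulOfNeZero a ha.ne')
  rw [← fracLaplacian_comp_smul hn hρ hf hfc ha, ← fracLaplacian_const_mul hn hρ hfa hca]
  rfl

lemma measurableSet_spaceTime : MeasurableSet (spaceTime n) :=
  measurableSet_Ici.prod MeasurableSet.univ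

lemma MemLpLoc.integrableOn_rpow_mul {p : ℝ} (hp : 1 < p)
    {u : ℝ × EuclideanSpace ℝ (Fin n) → ℝ} (hu : MemLpLoc p u)
    {ψ : ℝ × EuclideanSpace ℝ (Fin n) → ℝ} (hψ : Continuous ψ) (hc : HasCompactSupport ψ) :
    IntegrableOn (fun z => |u z| ^ p * ψ z) (spaceTime n) := by
  have hclosed : IsClosed (spaceTime n) := isClosed_Ici.prod isClosed_univ
  have hK : IsCompact (tsupport ψ ∩ spaceTime n) := hc.isCompact.inter_right hclosed
  have h1 := (hu _ hK inter_subset_right).integrable_norm_rpow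
    (by simp; linarith) ENNReal.ofReal_ne_top
  rw [ENNReal.toReal_ofReal (by linarith)] at h1
  obtain ⟨C, hC⟩ := hc.exists_bound_of_continuous hψ
  have h2 : IntegrableOn (fun z => |u z| ^ p * ψ z) (tsupport ψ ∩ spaceTime n) :=
    h1.mul_bdd (c := C) hψ.aestronglyMeasurable (Filter.Eventually.of_forall hC)
  refine h2.of_forall_sdiff_eq_zero measurableSet_spaceTime fun z hz => ?_
  have : z ∉ tsupport ψ := fun h => hz.2 ⟨h, hz.1⟩
  rw [image_eq_zero_of_notMem_tsupport this, mul_zero]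

end TestFunctions

/-! ### The test function argument for an abstract profile. -/

section Core

variable {n : ℕ}

/-- A spatial profile `φ` with admissible truncations `f k` for the test function method: the
truncations increase to `φ`, and all fractional Laplacians occurring in the equation are controlled
by `φ^(1/p) h` with `h` in the dual Lebesgue space. -/
structure IsAdmissibleProfile (σ δ p : ℝ) (φ h : EuclideanSpace ℝ (Fin n) → ℝ)
    (f : ℕ → EuclideanSpace ℝ (Fin n) → ℝ) (C : ℝ) : Prop where
  const_nonneg : 0 ≤ C
  continuous_profile : Continuous φ
  profile_zero : φ 0 = 1
  profile_le_one : ∀ x, φ x ≤ 1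
  dual_nonneg : ∀ x, 0 ≤ h x
  integrable_dual : Integrable (fun x => h x ^ (p / (p - 1)))
  contDiff : ∀ k, ContDiff ℝ ∞ (f k)
  hasCompactSupport : ∀ k, HasCompactSupport (f k)
  nonneg : ∀ k x, 0 ≤ f k x
  le_profile : ∀ k x, f k x ≤ φ x
  tendsto : ∀ x, Filter.Tendsto (fun k => f k x) Filter.atTop (nhds (φ x))
  le_dual : ∀ k x, f k x ≤ C * (φ x ^ (1 / p) * h x)
  sigma_le : ∀ k x, |fracLaplacian σ (f k) x| ≤ C * (φ x ^ (1 / p) * h x)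
  two_delta_le : ∀ k x, |fracLaplacian (2 * δ) (f k) x| ≤ C * (φ x ^ (1 / p) * h x)
  delta_le : ∀ k x, |fracLaplacian δ (f k) x| ≤ C * (φ x ^ (1 / p) * h x)

/-- The weak identity tested against a rescaled truncation. -/
lemma IsGlobalWeakSolution.test_le {σ δ p : ℝ} {u₁ : EuclideanSpace ℝ (Fin n) → ℝ}
    {u : ℝ × EuclideanSpace ℝ (Fin n) → ℝ} (hu : IsGlobalWeakSolution σ δ p u₁ u) (hn : n ≠ 0)
    (hδ : 0 < δ) (hδσ : δ < σ / 2) {φ h : EuclideanSpace ℝ (Fin n) → ℝ}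
    {f : ℕ → EuclideanSpace ℝ (Fin n) → ℝ} {C : ℝ} (hφ : IsAdmissibleProfile σ δ p φ h f C)
    {η : ℝ → ℝ} (hη : ContDiff ℝ ∞ η) (hηc : HasCompactSupport η) {D : ℝ}
    (hD : ∀ i ≤ 2, ∀ t, ‖iteratedFDeriv ℝ i η t‖ ≤ D * η t ^ (1 / p))
    (hη0 : η 0 = 1) {a : ℝ} (ha0 : 0 < a) (ha1 : a ≤ 1)
    (hint : IntegrableOn (fun z => |u z| * (η (a ^ (2 * δ) * z.1) ^ (1 / p) *
      (φ (a • z.2) ^ (1 / p) * h (a • z.2)))) (spaceTime n)) (k : ℕ) :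
    ∫ z in spaceTime n, |u z| ^ p * scaledProduct η (f k) (a ^ (2 * δ)) a z ≤
      (∫ z in spaceTime n, 5 * D * C * (a ^ (2 * δ)) ^ 2 * (|u z| *
        (η (a ^ (2 * δ) * z.1) ^ (1 / p) * (φ (a • z.2) ^ (1 / p) * h (a • z.2))))) -
      ∫ x, u₁ x * f k (a • x) := by
  have hσ : 0 < σ := by linarith
  -- This time scale gives the terms `ψ_tt`, `(-Δ)^(2δ) ψ` and `(-Δ)^δ ψ_t` the common size `τ²`.
  set τ := a ^ (2 * δ) with hτ
  have hτ0 : 0 < τ := Real.rpow_pos_of_pos ha0 _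
  have hC := hφ.const_nonneg
  set ψ := scaledProduct η (f k) τ a with hψ
  have htest : IsTestFunction ψ :=
    isTestFunction_scaledProduct hη hηc (hφ.contDiff k) (hφ.hasCompactSupport k) hτ0.ne' ha0.ne'
  have hid := hu.weak_identity ψ htest
  have hη1 : ContDiff ℝ ∞ (deriv η) := (contDiff_infty_iff_deriv.1 hη).2
  have hd0 : ∀ t, |η t| ≤ D * η t ^ (1 / p) := fun t => by
    have := hD 0 (by norm_num) t
    rwa [norm_iteratedFDeriv_zero, Real.norm_eq_abs] at this
  have hd1 : ∀ t, |deriv η t| ≤ D * η t ^ (1 / p) := fun t => by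
    have := hD 1 (by norm_num) t
    rwa [norm_iteratedFDeriv_eq_norm_iteratedDeriv, iteratedDeriv_one, Real.norm_eq_abs] at this
  have hd2 : ∀ t, |deriv (deriv η) t| ≤ D * η t ^ (1 / p) := fun t => by
    have := hD 2 le_rfl t
    rwa [norm_iteratedFDeriv_eq_norm_iteratedDeriv, iteratedDeriv_succ, iteratedDeriv_one,
      Real.norm_eq_abs] at this
  have hψt : timeDeriv ψ = scaledProduct (fun t => τ * deriv η t) (f k) τ a :=
    timeDeriv_scaledProduct hη _ _ _
  have hψtt : timeDeriv (timeDeriv ψ) =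
      scaledProduct (fun t => τ * deriv (fun s => τ * deriv η s) t) (f k) τ a := by
    rw [hψt]
    exact timeDeriv_scaledProduct (contDiff_const.mul hη1) _ _ _
  set g : ℝ × EuclideanSpace ℝ (Fin n) → ℝ := fun z => |u z| *
    (η (τ * z.1) ^ (1 / p) * (φ (a • z.2) ^ (1 / p) * h (a • z.2))) with hg
  have hτsq : a ^ (2 * (2 * δ)) = τ ^ 2 := by
    rw [hτ, ← Real.rpow_natCast, ← Real.rpow_mul ha0.le]
    congr 1; push_cast; ring
  -- The `σ`-term is of no larger order, since `a ≤ 1` and `2δ < σ`.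
  have hσle : a ^ (2 * σ) ≤ τ ^ 2 := by
    rw [← hτsq]
    exact Real.rpow_le_rpow_of_exponent_ge ha0 ha1 (by linarith)
  have bound : ∀ G : ℝ × EuclideanSpace ℝ (Fin n) → ℝ,
      (∀ z, |G z| ≤ D * C * τ ^ 2 * g z) →
      |∫ z in spaceTime n, G z| ≤ D * C * τ ^ 2 * ∫ z in spaceTime n, g z := by
    intro G hG
    rw [← integral_const_mul]
    exact norm_integral_le_of_norm_le (f := G) (g := fun z => D * C * τ ^ 2 * g z)
      (hint.const_mul _) (Filter.Eventually.of_forall hG)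
  have core : ∀ (z : ℝ × EuclideanSpace ℝ (Fin n)) (A e F : ℝ),
      |A| ≤ D * η (τ * z.1) ^ (1 / p) → 0 ≤ e → e ≤ τ ^ 2 →
      |F| ≤ C * (φ (a • z.2) ^ (1 / p) * h (a • z.2)) →
      |u z * (A * (e * F))| ≤ D * C * τ ^ 2 * g z := by
    intro z A e F hA he0 he hF
    rw [abs_mul, abs_mul, abs_mul, abs_of_nonneg he0]
    calc |u z| * (|A| * (e * |F|)) ≤ |u z| * ((D * η (τ * z.1) ^ (1 / p)) * (τ ^ 2 *
          (C * (φ (a • z.2) ^ (1 / p) * h (a • z.2))))) := by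
          gcongr
          exact (abs_nonneg A).trans hA
      _ = _ := by simp only [hg]; ring
  have b1 := bound (fun z => u z * timeDeriv (timeDeriv ψ) z) (fun z => by
    have e : timeDeriv (timeDeriv ψ) z = deriv (deriv η) (τ * z.1) * (τ ^ 2 * f k (a • z.2)) := by
      rw [hψtt]
      simp only [scaledProduct, deriv_const_mul_field]
      ring
    simp only [e]
    refine core z _ _ _ (hd2 _) (by positivity) le_rfl ?_
    rw [abs_of_nonneg (hφ.nonneg k _)]
    exact hφ.le_dual k _)
  have b2 := bound (fun z => spaceFracLaplacian σ ψ z * u z) (fun z => by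
    rw [mul_comm, hψ, spaceFracLaplacian_scaledProduct hn hσ η (hφ.contDiff k)
      (hφ.hasCompactSupport k) τ ha0]
    exact core z _ _ _ (hd0 _) (by positivity) hσle (hφ.sigma_le k _))
  have b3 := bound (fun z => spaceFracLaplacian (2 * δ) ψ z * u z) (fun z => by
    rw [mul_comm, hψ, spaceFracLaplacian_scaledProduct hn (by linarith) η (hφ.contDiff k)
      (hφ.hasCompactSupport k) τ ha0]
    exact core z _ _ _ (hd0 _) (by positivity) hτsq.le (hφ.two_delta_le k _))
  have b4 := bound (fun z => spaceFracLaplacian δ (timeDeriv ψ) z * u z) (fun z => by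
    rw [mul_comm, hψt, spaceFracLaplacian_scaledProduct hn hδ _ (hφ.contDiff k)
      (hφ.hasCompactSupport k) τ ha0]
    have e : τ * deriv η (τ * z.1) * (a ^ (2 * δ) * fracLaplacian δ (f k) (a • z.2)) =
        deriv η (τ * z.1) * (τ ^ 2 * fracLaplacian δ (f k) (a • z.2)) := by
      rw [← hτ]; ring
    rw [e]
    exact core z _ _ _ (hd1 _) (by positivity) le_rfl (hφ.delta_le k _))
  have hinit : ∀ x, ψ (0, x) = f k (a • x) := by
    intro x
    simp [hψ, scaledProduct, hη0]
  simp_rw [hinit] at hid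
  rw [integral_const_mul]
  rw [abs_le] at b1 b2 b3 b4
  -- The `5` is `1 + 1 + 1 + 2`, the mixed term being counted twice; it enters with a minus sign, so
  -- its lower bound is the one used.
  change _ ≤ 5 * D * C * τ ^ 2 * (∫ z in spaceTime n, g z) - _
  rw [hid]
  linarith [b1.2, b2.2, b3.2, b4.1]

/-- The time cutoff vanishes for `t ≥ 2 / τ`, so integrability on one finite slab is enough. -/
lemma integrableOn_cutoff_mul {p : ℝ} (hp : 1 < p) {η : ℝ → ℝ} (hη : Continuous η)
    (hη0 : ∀ t, 0 ≤ η t) (hη1 : ∀ t, η t ≤ 1) (hη2 : ∀ t, 2 ≤ ‖t‖ → η t = 0)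
    {v : ℝ × EuclideanSpace ℝ (Fin n) → ℝ} {w : EuclideanSpace ℝ (Fin n) → ℝ} {τ : ℝ} (hτ : 0 < τ)
    (hv : IntegrableOn (fun z => v z * w z.2) (Icc 0 (2 / τ) ×ˢ univ)) :
    IntegrableOn (fun z => v z * (η (τ * z.1) ^ (1 / p) * w z.2)) (spaceTime n) := by
  have hp0 : 0 ≤ 1 / p := by positivity
  have h1 : IntegrableOn (fun z : ℝ × EuclideanSpace ℝ (Fin n) =>
      η (τ * z.1) ^ (1 / p) * (v z * w z.2)) (Icc 0 (2 / τ) ×ˢ univ) := by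
    refine Integrable.bdd_mul (c := 1) hv ?_ (Filter.Eventually.of_forall fun z => ?_)
    · exact ((hη.comp (by fun_prop)).rpow_const fun _ => Or.inr hp0).aestronglyMeasurable
    · rw [Real.norm_eq_abs, abs_of_nonneg (Real.rpow_nonneg (hη0 _) _)]
      exact Real.rpow_le_one (hη0 _) (hη1 _) hp0
  have h2 : (fun z : ℝ × EuclideanSpace ℝ (Fin n) => v z * (η (τ * z.1) ^ (1 / p) * w z.2)) =
      fun z => η (τ * z.1) ^ (1 / p) * (v z * w z.2) := by
    ext z; ring
  rw [h2]
  refine h1.of_forall_sdiff_eq_zero measurableSet_spaceTime fun z hz => ?_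
  have hz0 : 0 ≤ z.1 := hz.1.1
  have hz1 : 2 / τ < z.1 := by
    by_contra h
    push Not at h
    exact hz.2 ⟨⟨hz0, h⟩, mem_univ _⟩
  have h3 : 2 ≤ ‖τ * z.1‖ := by
    rw [div_lt_iff₀ hτ] at hz1
    rw [Real.norm_eq_abs, abs_of_nonneg (by positivity)]
    linarith
  rw [hη2 _ h3, Real.zero_rpow (by positivity), zero_mul]

/-- The constants `1/p` and `1/p'` are dropped; coefficient one on `a ^ p` is what lets the
nonlinear term cancel exactly. -/
lemma young_pow_le {p : ℝ} (hp : 1 < p) {a b : ℝ} (ha : 0 ≤ a) (hb : 0 ≤ b) :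
    a * b ≤ a ^ p + b ^ (p / (p - 1)) := by
  have hpq : p.HolderConjugate (p / (p - 1)) := Real.HolderConjugate.conjExponent hp
  refine (Real.young_inequality_of_nonneg ha hb hpq).trans (add_le_add ?_ ?_)
  · exact div_le_self (Real.rpow_nonneg ha _) hp.le
  · exact div_le_self (Real.rpow_nonneg hb _) hpq.symm.lt.le

/-- Supplies the volume factors of the final estimate: `T`, which will be `2 a^(-2δ)`, from time and
`a^(-n)` from the spatial dilation. -/
lemma integral_Icc_prod_dual {h : EuclideanSpace ℝ (Fin n) → ℝ} {q : ℝ}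
    (hh : Integrable (fun x => h x ^ q)) {T a : ℝ} (hT : 0 ≤ T) (ha : 0 < a) (K : ℝ)
    (hK : 0 ≤ K) (hh0 : ∀ x, 0 ≤ h x) :
    IntegrableOn (fun z : ℝ × EuclideanSpace ℝ (Fin n) => (K * h (a • z.2)) ^ q)
      (Icc 0 T ×ˢ univ) ∧
    ∫ z in Icc 0 T ×ˢ univ, (fun z : ℝ × EuclideanSpace ℝ (Fin n) => (K * h (a • z.2)) ^ q) z =
      K ^ q * T * (a ^ n)⁻¹ * ∫ x, h x ^ q := by
  have h1 : ∀ x, (K * h (a • x)) ^ q = K ^ q * h (a • x) ^ q := fun x =>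
    Real.mul_rpow hK (hh0 _)
  have h2 : Integrable (fun x => h (a • x) ^ q) := hh.comp_smul ha.ne'
  have h3 : (fun z : ℝ × EuclideanSpace ℝ (Fin n) => (K * h (a • z.2)) ^ q) =
      fun z => (1 : ℝ) * (K ^ q * h (a • z.2) ^ q) := by
    ext z; rw [h1, one_mul]
  have hμ : (volume : Measure (ℝ × EuclideanSpace ℝ (Fin n))).restrict (Icc 0 T ×ˢ univ) =
      (volume.restrict (Icc 0 T)).prod volume := by
    rw [Measure.volume_eq_prod, ← Measure.prod_restrict, Measure.restrict_univ]
  constructor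
  · rw [h3, IntegrableOn, hμ]
    exact (integrable_const (1 : ℝ)).mul_prod (h2.const_mul _)
  · rw [h3, hμ, integral_prod_mul (fun _ : ℝ => (1 : ℝ)) (fun x => K ^ q * h (a • x) ^ q),
      integral_const_mul, Measure.integral_comp_smul volume (fun x => h x ^ q) a]
    simp [hT, abs_of_pos ha]
    ring

/-- The rescaled weak inequality after letting the truncation go to infinity. -/
lemma IsGlobalWeakSolution.integral_mul_profile_le {σ δ p : ℝ}
    {u₁ : EuclideanSpace ℝ (Fin n) → ℝ}
    {u : ℝ × EuclideanSpace ℝ (Fin n) → ℝ} (hu : IsGlobalWeakSolution σ δ p u₁ u) (hn : n ≠ 0)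
    (hu₁ : Integrable u₁) (hp : 1 < p)
    (hδ : 0 < δ) (hδσ : δ < σ / 2) {φ h : EuclideanSpace ℝ (Fin n) → ℝ}
    {f : ℕ → EuclideanSpace ℝ (Fin n) → ℝ} {C : ℝ} (hφ : IsAdmissibleProfile σ δ p φ h f C)
    {η : ℝ → ℝ} (hη : ContDiff ℝ ∞ η) (hηc : HasCompactSupport η)
    (hη0 : ∀ t, 0 ≤ η t) (hη1 : ∀ t, η t ≤ 1) (hη2 : ∀ t, 2 ≤ ‖t‖ → η t = 0) {D : ℝ} (hD0 : 0 ≤ D)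
    (hD : ∀ i ≤ 2, ∀ t, ‖iteratedFDeriv ℝ i η t‖ ≤ D * η t ^ (1 / p))
    (hηz : η 0 = 1) {a : ℝ} (ha0 : 0 < a) (ha1 : a ≤ 1)
    (hint : ∀ T : ℝ, IntegrableOn (fun z => |u z| * (φ (a • z.2) ^ (1 / p) * h (a • z.2)))
      (Icc 0 T ×ˢ univ)) :
    ∫ x, u₁ x * φ (a • x) ≤ (5 * D * C) ^ (p / (p - 1)) * 2 * (∫ x, h x ^ (p / (p - 1))) *
      a ^ (4 * δ * (p / (p - 1)) - 2 * δ - n) := by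
  set q := p / (p - 1) with hq
  set τ := a ^ (2 * δ) with hτ
  have hτ0 : 0 < τ := Real.rpow_pos_of_pos ha0 _
  have hC := hφ.const_nonneg
  have hp0 : 0 < p := by linarith
  set K := 5 * D * C * τ ^ 2 with hK
  have hK0 : 0 ≤ K := by positivity
  have hφ0 : ∀ x, 0 ≤ φ x := fun x => ge_of_tendsto' (hφ.tendsto x) fun k => hφ.nonneg k x
  set g : ℝ × EuclideanSpace ℝ (Fin n) → ℝ := fun z => |u z| *
    (η (τ * z.1) ^ (1 / p) * (φ (a • z.2) ^ (1 / p) * h (a • z.2))) with hg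
  have hgi : IntegrableOn g (spaceTime n) :=
    integrableOn_cutoff_mul (v := fun z => |u z|)
      (w := fun x => φ (a • x) ^ (1 / p) * h (a • x)) hp hη.continuous hη0 hη1 hη2 hτ0 (hint _)
  set G : ℝ × EuclideanSpace ℝ (Fin n) → ℝ := fun z => |u z| ^ p * scaledProduct η φ τ a z
    with hG
  have hG0 : ∀ z, 0 ≤ G z := fun z => mul_nonneg (Real.rpow_nonneg (abs_nonneg _) _)
    (mul_nonneg (hη0 _) (hφ0 _))
  have hdom : Filter.Tendsto (fun k => ∫ x, u₁ x * f k (a • x)) Filter.atTop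
      (nhds (∫ x, u₁ x * φ (a • x))) := by
    refine tendsto_integral_of_dominated_convergence (fun x => ‖u₁ x‖) (fun k => ?_) hu₁.norm
      (fun k => Filter.Eventually.of_forall fun x => ?_)
      (Filter.Eventually.of_forall fun x => (hφ.tendsto _).const_mul _)
    · exact hu₁.aestronglyMeasurable.mul
        ((hφ.contDiff k).continuous.comp (continuous_const_smul a)).aestronglyMeasurable
    · rw [norm_mul, Real.norm_eq_abs (f k _), abs_of_nonneg (hφ.nonneg k _)]
      exact mul_le_of_le_one_right (norm_nonneg _) ((hφ.le_profile k _).trans (hφ.profile_le_one _))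
  -- Since `φ` need not have compact support, integrability of `|u|^p ψ` is not covered by `u ∈
  -- L^p_loc`; Fatou provides it, and without it the absorption below would be meaningless.
  obtain ⟨hGi, hGle⟩ := integrable_and_integral_le_of_tendsto
    (μ := volume.restrict (spaceTime n)) (G := G)
    (F := fun k z => |u z| ^ p * scaledProduct η (f k) τ a z)
    (B := fun k => (∫ z in spaceTime n, K * g z) - ∫ x, u₁ x * f k (a • x))
    (b := (∫ z in spaceTime n, K * g z) - ∫ x, u₁ x * φ (a • x))
    (fun k => by
      have ht := isTestFunction_scaledProduct hη hηc (hφ.contDiff k) (hφ.hasCompactSupport k)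
        hτ0.ne' ha0.ne'
      exact hu.memLpLoc.integrableOn_rpow_mul hp ht.1.continuous ht.2)
    (fun k z => mul_nonneg (Real.rpow_nonneg (abs_nonneg _) _)
      (mul_nonneg (hη0 _) (hφ.nonneg k _)))
    (fun z => ((hφ.tendsto _).const_mul _).const_mul _)
    (fun k => hu.test_le hn hδ hδσ hφ hη hηc hD hηz ha0 ha1 hgi k)
    (hdom.const_sub _)
  set S : Set (ℝ × EuclideanSpace ℝ (Fin n)) := Icc 0 (2 / τ) ×ˢ univ with hS
  have hSm : MeasurableSet S := measurableSet_Icc.prod MeasurableSet.univ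
  set Q : ℝ × EuclideanSpace ℝ (Fin n) → ℝ := fun z => (K * h (a • z.2)) ^ q with hQ
  obtain ⟨hQi, hQe⟩ := integral_Icc_prod_dual (q := q) hφ.integrable_dual
    (T := 2 / τ) (by positivity) ha0 K hK0 hφ.dual_nonneg
  have hpt : ∀ z ∈ spaceTime n, K * g z ≤ G z + S.indicator Q z := by
    intro z hz
    by_cases hzS : z ∈ S
    · rw [indicator_of_mem hzS]
      have hy := young_pow_le hp (a := |u z| * (η (τ * z.1) ^ (1 / p) * φ (a • z.2) ^ (1 / p)))
        (b := K * h (a • z.2))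
        (mul_nonneg (abs_nonneg _) (mul_nonneg (Real.rpow_nonneg (hη0 _) _)
          (Real.rpow_nonneg (hφ0 _) _))) (mul_nonneg hK0 (hφ.dual_nonneg _))
      have e1 : (|u z| * (η (τ * z.1) ^ (1 / p) * φ (a • z.2) ^ (1 / p))) ^ p = G z := by
        rw [Real.mul_rpow (abs_nonneg _) (mul_nonneg (Real.rpow_nonneg (hη0 _) _)
          (Real.rpow_nonneg (hφ0 _) _)), Real.mul_rpow (Real.rpow_nonneg (hη0 _) _)
          (Real.rpow_nonneg (hφ0 _) _), ← Real.rpow_mul (hη0 _), ← Real.rpow_mul (hφ0 _),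
          one_div_mul_cancel hp0.ne', Real.rpow_one, Real.rpow_one]
        rfl
      rw [e1] at hy
      refine le_trans (le_of_eq ?_) hy
      simp only [hg]
      ring
    · rw [indicator_of_notMem hzS, add_zero]
      have hz0 : 0 ≤ z.1 := hz.1
      have hz1 : 2 / τ < z.1 := by
        by_contra hcon
        push Not at hcon
        exact hzS ⟨⟨hz0, hcon⟩, mem_univ _⟩
      rw [div_lt_iff₀ hτ0] at hz1
      have h3 : 2 ≤ ‖τ * z.1‖ := by
        rw [Real.norm_eq_abs, abs_of_nonneg (by positivity)]
        linarith
      have h4 : K * g z = 0 := by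
        simp only [hg]
        rw [hη2 _ h3, Real.zero_rpow (by positivity)]
        ring
      rw [h4]
      exact hG0 z
  have hSs : S ⊆ spaceTime n := fun z hz => ⟨hz.1.1, mem_univ _⟩
  have hind : Integrable (S.indicator Q) (volume.restrict (spaceTime n)) :=
    ((integrable_indicator_iff hSm).2 hQi).integrableOn
  have hle : ∫ z in spaceTime n, K * g z ≤
      (∫ z in spaceTime n, G z) + K ^ q * (2 / τ) * (a ^ n)⁻¹ * ∫ x, h x ^ q := by
    have hSQ : ∫ z in S, Q z = ∫ z in spaceTime n, S.indicator Q z := by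
      rw [setIntegral_indicator hSm, inter_eq_self_of_subset_right hSs]
    rw [← hQe]
    change _ ≤ _ + ∫ z in S, Q z
    rw [hSQ, ← integral_add hGi hind]
    exact setIntegral_mono_on (hgi.const_mul K) (hGi.add hind) measurableSet_spaceTime hpt
  -- The finite integral of `G` appears on both sides and cancels.
  have hfin : ∫ x, u₁ x * φ (a • x) ≤ K ^ q * (2 / τ) * (a ^ n)⁻¹ * ∫ x, h x ^ q := by linarith
  refine hfin.trans (le_of_eq ?_)
  have e1 : K ^ q = (5 * D * C) ^ q * a ^ (4 * δ * q) := by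
    rw [hK, Real.mul_rpow (by positivity) (by positivity), hτ, ← Real.rpow_natCast,
      ← Real.rpow_mul ha0.le, ← Real.rpow_mul ha0.le]
    congr 2; push_cast; ring
  have e2 : (2 / τ) = 2 * a ^ (-(2 * δ)) := by
    rw [hτ, Real.rpow_neg ha0.le, div_eq_mul_inv]
  have e3 : (a ^ n)⁻¹ = a ^ (-(n : ℝ)) := by
    rw [Real.rpow_neg ha0.le, Real.rpow_natCast]
  have e4 : a ^ (4 * δ * q - 2 * δ - n) =
      a ^ (4 * δ * q) * a ^ (-(2 * δ)) * a ^ (-(n : ℝ)) := by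
    rw [← Real.rpow_add ha0, ← Real.rpow_add ha0]
    congr 1
  rw [e1, e2, e3, e4]
  ring

/-- The test function method: an admissible profile against which a global weak solution is
integrable forces the mean of the initial velocity to be nonpositive in the subcritical range. -/
lemma IsGlobalWeakSolution.integral_nonpos {σ δ p : ℝ} {u₁ : EuclideanSpace ℝ (Fin n) → ℝ}
    {u : ℝ × EuclideanSpace ℝ (Fin n) → ℝ} (hu : IsGlobalWeakSolution σ δ p u₁ u)
    (hδ : 0 < δ) (hδσ : δ < σ / 2) (hn : 2 * δ < n) (hu₁ : Integrable u₁) (hp : 1 < p)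
    (hp_lt : p < 1 + 4 * δ / (n - 2 * δ)) {φ h : EuclideanSpace ℝ (Fin n) → ℝ}
    {f : ℕ → EuclideanSpace ℝ (Fin n) → ℝ} {C : ℝ} (hφ : IsAdmissibleProfile σ δ p φ h f C)
    (hint : ∀ a : ℝ, 0 < a → a ≤ 1 → ∀ T : ℝ, IntegrableOn
      (fun z => |u z| * (φ (a • z.2) ^ (1 / p) * h (a • z.2))) (Icc 0 T ×ˢ univ)) :
    ∫ x, u₁ x ≤ 0 := by
  have hn0 : n ≠ 0 := by
    rintro rfl
    simp only [Nat.cast_zero] at hn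
    linarith
  obtain ⟨η, hη, hηc, hη0, hη1, hηz, hη2, D, hD0, hD⟩ := exists_cutoff (E := ℝ) 2 hp
  set ε := 4 * δ * (p / (p - 1)) - 2 * δ - n with hε
  -- Multiplied by `p - 1`, the exponent becomes `4δ - (p - 1)(n - 2δ)`, which is positive exactly
  -- in the subcritical range.
  have hε0 : 0 < ε := by
    have h1 : (p - 1) * (n - 2 * δ) < 4 * δ := by
      rw [← lt_div_iff₀ (by linarith)]
      linarith
    have h2 : n + 2 * δ < 4 * δ * p / (p - 1) := by
      rw [lt_div_iff₀ (by linarith)]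
      linarith
    rw [hε, ← mul_div_assoc]
    linarith
  set A := (5 * D * C) ^ (p / (p - 1)) * 2 * (∫ x, h x ^ (p / (p - 1)))
  have ha0 : ∀ N : ℕ, (0 : ℝ) < 1 / ((N : ℝ) + 1) := fun N => Nat.one_div_pos_of_nat
  have ha1 : ∀ N : ℕ, 1 / ((N : ℝ) + 1) ≤ 1 := fun N => by
    rw [div_le_one (by positivity)]
    linarith [N.cast_nonneg (α := ℝ)]
  have hle : ∀ N : ℕ, ∫ x, u₁ x * φ ((1 / ((N : ℝ) + 1)) • x) ≤ A * (1 / ((N : ℝ) + 1)) ^ ε :=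
    fun N => hu.integral_mul_profile_le hn0 hu₁ hp hδ hδσ hφ hη hηc hη0 hη1 hη2 hD0 hD hηz
      (ha0 N) (ha1 N) (hint _ (ha0 N) (ha1 N))
  have hlim0 := tendsto_one_div_add_atTop_nhds_zero_nat (𝕜 := ℝ)
  have hR : Filter.Tendsto (fun N : ℕ => A * (1 / ((N : ℝ) + 1)) ^ ε) Filter.atTop (nhds 0) := by
    have := (hlim0.rpow_const (Or.inr hε0.le)).const_mul A
    rwa [Real.zero_rpow hε0.ne', mul_zero] at this
  have hφ0 : ∀ x, 0 ≤ φ x := fun x => ge_of_tendsto' (hφ.tendsto x) fun k => hφ.nonneg k x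
  have hL : Filter.Tendsto (fun N : ℕ => ∫ x, u₁ x * φ ((1 / ((N : ℝ) + 1)) • x)) Filter.atTop
      (nhds (∫ x, u₁ x)) := by
    refine tendsto_integral_of_dominated_convergence (fun x => ‖u₁ x‖) (fun N => ?_) hu₁.norm
      (fun N => Filter.Eventually.of_forall fun x => ?_)
      (Filter.Eventually.of_forall fun x => ?_)
    · exact hu₁.aestronglyMeasurable.mul
        (hφ.continuous_profile.comp (continuous_const_smul _)).aestronglyMeasurable
    · rw [norm_mul, Real.norm_eq_abs (φ _), abs_of_nonneg (hφ0 _)]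
      exact mul_le_of_le_one_right (norm_nonneg _) (hφ.profile_le_one _)
    · have h1 : Filter.Tendsto (fun N : ℕ => (1 / ((N : ℝ) + 1)) • x) Filter.atTop
          (nhds ((0 : ℝ) • x)) := hlim0.smul_const x
      have h2 := ((hφ.continuous_profile.tendsto _).comp h1).const_mul (u₁ x)
      rwa [zero_smul, hφ.profile_zero, mul_one] at h2
  exact le_of_tendsto_of_tendsto' hL hR hle

end Core

/-! ### Integrability of weak solutions against polynomial weights. -/

section LocalIntegrability

variable {n : ℕ}

lemma MemLpLoc.integrableOn {p : ℝ} (hp : 1 < p) {u : ℝ × EuclideanSpace ℝ (Fin n) → ℝ}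
    (hu : MemLpLoc p u) {K : Set (ℝ × EuclideanSpace ℝ (Fin n))} (hK : IsCompact K)
    (hKs : K ⊆ spaceTime n) : IntegrableOn u K := by
  have : IsFiniteMeasure (volume.restrict K) := isFiniteMeasure_restrict.2 hK.measure_ne_top
  exact (hu K hK hKs).integrable (ENNReal.one_le_ofReal.2 hp.le)

lemma MemLpLoc.aestronglyMeasurable {p : ℝ} (hp : 1 < p)
    {u : ℝ × EuclideanSpace ℝ (Fin n) → ℝ} (hu : MemLpLoc p u) :
    AEStronglyMeasurable u (volume.restrict (spaceTime n)) := by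
  have hcov : spaceTime n = ⋃ N : ℕ, Icc (0 : ℝ) N ×ˢ Metric.closedBall 0 (N : ℝ) := by
    ext z
    simp only [spaceTime, mem_prod, mem_Ici, mem_univ, and_true, mem_iUnion, mem_Icc,
      Metric.mem_closedBall, dist_zero_right]
    constructor
    · intro hz
      obtain ⟨N, hN⟩ := exists_nat_ge (max z.1 ‖z.2‖)
      exact ⟨N, ⟨hz, (le_max_left _ _).trans hN⟩, (le_max_right _ _).trans hN⟩
    · rintro ⟨N, ⟨hz, _⟩, _⟩
      exact hz
  rw [hcov, aestronglyMeasurable_iUnion_iff]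
  intro N
  exact (hu.integrableOn hp (isCompact_Icc.prod (isCompact_closedBall _ _))
    fun z hz => ⟨hz.1.1, mem_univ _⟩).aestronglyMeasurable

/-- If `u` is integrable against a separated function whose spatial factor is bounded below by the
weight at infinity, then `u` is integrable against the weight, locally in time. -/
lemma integrableOn_mul_bracketWeight {p : ℝ} (hp : 1 < p)
    {u : ℝ × EuclideanSpace ℝ (Fin n) → ℝ} (hu : MemLpLoc p u) {b c T : ℝ} (hb : 0 ≤ b)
    (hc : 0 < c) {ζ : ℝ → ℝ} (hζ : ∀ t ∈ Icc 0 T, ζ t = 1) {g : EuclideanSpace ℝ (Fin n) → ℝ}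
    (hg : ∀ x, 2 ≤ ‖x‖ → c * bracketWeight b x ≤ |g x|)
    (hint : IntegrableOn (fun z => ζ z.1 * g z.2 * u z) (spaceTime n)) :
    IntegrableOn (fun z => |u z| * bracketWeight b z.2) (Icc 0 T ×ˢ univ) := by
  have hw : Continuous fun z : ℝ × EuclideanSpace ℝ (Fin n) => bracketWeight b z.2 :=
    (continuous_bracketWeight b).comp continuous_snd
  have hsplit : Icc (0 : ℝ) T ×ˢ (univ : Set (EuclideanSpace ℝ (Fin n))) =
      Icc 0 T ×ˢ Metric.closedBall 0 2 ∪ Icc 0 T ×ˢ (Metric.closedBall 0 2)ᶜ := by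
    rw [← prod_union, union_compl_self]
  rw [hsplit]
  refine IntegrableOn.union ?_ ?_
  · refine Integrable.mul_bdd (c := 1) (hu.integrableOn hp
      (isCompact_Icc.prod (isCompact_closedBall _ _)) fun z hz => ⟨hz.1.1, mem_univ _⟩).abs
      hw.aestronglyMeasurable (Filter.Eventually.of_forall fun z => ?_)
    rw [Real.norm_eq_abs, abs_of_pos (bracketWeight_pos b _)]
    exact bracketWeight_le_one hb _
  · have hsub : Icc (0 : ℝ) T ×ˢ (Metric.closedBall (0 : EuclideanSpace ℝ (Fin n)) 2)ᶜ ⊆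
        spaceTime n := fun z hz => ⟨hz.1.1, mem_univ _⟩
    have hm : MeasurableSet
        (Icc (0 : ℝ) T ×ˢ (Metric.closedBall (0 : EuclideanSpace ℝ (Fin n)) 2)ᶜ) :=
      measurableSet_Icc.prod Metric.isClosed_closedBall.measurableSet.compl
    refine ((hint.mono_set hsub).norm.const_mul c⁻¹).mono' ?_ ?_
    · have h1 := (hu.aestronglyMeasurable hp).mono_measure (Measure.restrict_mono hsub le_rfl)
      exact h1.norm.mul hw.aestronglyMeasurable
    · filter_upwards [ae_restrict_mem hm] with z hz
      have hz2 : 2 ≤ ‖z.2‖ := by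
        have := hz.2
        simp only [mem_compl_iff, Metric.mem_closedBall, dist_zero_right, not_le] at this
        exact this.le
      rw [hζ _ hz.1, one_mul, ← div_eq_inv_mul, le_div_iff₀ hc]
      simp only [norm_mul, Real.norm_eq_abs, abs_abs, abs_of_pos (bracketWeight_pos b _)]
      have := mul_le_mul_of_nonneg_right (hg _ hz2) (abs_nonneg (u z))
      linarith

lemma exists_bump (n : ℕ) : ∃ f : EuclideanSpace ℝ (Fin n) → ℝ, ContDiff ℝ ∞ f ∧
    HasCompactSupport f ∧ (∀ x, 0 ≤ f x) ∧ (∀ x, 1 ≤ ‖x‖ → f x = 0) ∧ 0 < ∫ x, f x := by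
  let χ : ContDiffBump (0 : EuclideanSpace ℝ (Fin n)) := ⟨1 / 2, 1, by norm_num, by norm_num⟩
  refine ⟨χ, χ.contDiff, χ.hasCompactSupport, fun x => χ.nonneg, fun x hx => ?_, χ.integral_pos⟩
  exact χ.zero_of_le_dist (by simpa [χ] using hx)

/-- The cutoff equals one on an open interval containing `[0, T]`, so that `t χ(t)` has derivative
one on `[0, T]`, endpoints included. -/
lemma exists_time_cutoff (T : ℝ) : ∃ χ : ℝ → ℝ, ContDiff ℝ ∞ χ ∧ HasCompactSupport χ ∧
    ∀ t ∈ Ioo (-1) (T + 1), χ t = 1 := by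
  let χ : ContDiffBump (0 : ℝ) := ⟨|T| + 1, |T| + 2, by positivity, by linarith⟩
  refine ⟨χ, χ.contDiff, χ.hasCompactSupport, fun t ht => χ.one_of_mem_closedBall ?_⟩
  simp only [χ, Metric.mem_closedBall, dist_zero_right, Real.norm_eq_abs, abs_le]
  have := le_abs_self T
  have := abs_nonneg T
  constructor <;> linarith [ht.1, ht.2]

/-- The `σ`-clause of the definition, tested with `χ(t) f(x)` for a bump `f`, becomes integrability
against the weight through the lower bound on the tail of `(-Δ)^σ f`. -/
lemma IsGlobalWeakSolution.integrableOn_of_sigma {σ δ p : ℝ}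
    {u₁ : EuclideanSpace ℝ (Fin n) → ℝ}
    {u : ℝ × EuclideanSpace ℝ (Fin n) → ℝ} (hu : IsGlobalWeakSolution σ δ p u₁ u) (hn : n ≠ 0)
    (hp : 1 < p) (hσ : 0 < σ) (hint : ∀ k : ℕ, σ ≠ k) (T : ℝ) :
    IntegrableOn (fun z => |u z| * bracketWeight (n + 2 * σ) z.2) (Icc 0 T ×ˢ univ) := by
  obtain ⟨f, hf, hfc, hf0, hf1, hfI⟩ := exists_bump n
  obtain ⟨c, hc, hlow⟩ := exists_le_abs_fracLaplacian hn hσ hint hf hfc hf0 hf1 hfI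
  obtain ⟨χ, hχ, hχc, hχ1⟩ := exists_time_cutoff T
  have h := hu.integrable_sigma _
    (isTestFunction_scaledProduct hχ hχc hf hfc one_ne_zero one_ne_zero)
  refine integrableOn_mul_bracketWeight hp hu.memLpLoc (by positivity) hc
    (fun t ht => hχ1 t ⟨by linarith [ht.1], by linarith [ht.2]⟩) hlow ?_
  simpa [spaceFracLaplacian_scaledProduct hn hσ χ hf hfc 1 one_pos] using h

/-- The `δ`-clause involves `ψ_t`, so the time factor is `t χ(t)`, whose derivative is one on `[0,
T]`. -/
lemma IsGlobalWeakSolution.integrableOn_of_delta {σ δ p : ℝ}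
    {u₁ : EuclideanSpace ℝ (Fin n) → ℝ}
    {u : ℝ × EuclideanSpace ℝ (Fin n) → ℝ} (hu : IsGlobalWeakSolution σ δ p u₁ u) (hn : n ≠ 0)
    (hp : 1 < p) (hδ : 0 < δ) (hint : ∀ k : ℕ, δ ≠ k) (T : ℝ) :
    IntegrableOn (fun z => |u z| * bracketWeight (n + 2 * δ) z.2) (Icc 0 T ×ˢ univ) := by
  obtain ⟨f, hf, hfc, hf0, hf1, hfI⟩ := exists_bump n
  obtain ⟨c, hc, hlow⟩ := exists_le_abs_fracLaplacian hn hδ hint hf hfc hf0 hf1 hfI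
  obtain ⟨χ, hχ, hχc, hχ1⟩ := exists_time_cutoff T
  have hη : ContDiff ℝ ∞ (fun t : ℝ => t * χ t) := contDiff_id.mul hχ
  have h := hu.integrable_delta _
    (isTestFunction_scaledProduct hη hχc.mul_left hf hfc one_ne_zero one_ne_zero)
  rw [timeDeriv_scaledProduct hη] at h
  refine integrableOn_mul_bracketWeight (ζ := deriv fun t : ℝ => t * χ t) hp hu.memLpLoc
    (by positivity) hc (fun t ht => ?_) hlow ?_
  · have he : (fun t : ℝ => t * χ t) =ᶠ[nhds t] id := by
      filter_upwards [Ioo_mem_nhds (by linarith [ht.1] : -1 < t)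
        (by linarith [ht.2] : t < T + 1)] with s hs
      rw [hχ1 s hs, mul_one, id]
    rw [he.deriv_eq, deriv_id]
  · simpa [spaceFracLaplacian_scaledProduct hn hδ _ hf hfc 1 one_pos] using h

end LocalIntegrability

/-! ### Admissible profiles: polynomial weights and compactly supported cutoffs. -/

section Profiles

variable {n : ℕ}

/-- Truncations of the polynomial weight. -/
def truncatedWeight (χ : EuclideanSpace ℝ (Fin n) → ℝ) (b : ℝ) (k : ℕ)
    (x : EuclideanSpace ℝ (Fin n)) : ℝ :=
  χ (((k : ℝ) + 1)⁻¹ • x) * bracketWeight b x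

lemma contDiff_truncatedWeight {χ : EuclideanSpace ℝ (Fin n) → ℝ} (hχ : ContDiff ℝ ∞ χ) (b : ℝ)
    (k : ℕ) : ContDiff ℝ ∞ (truncatedWeight χ b k) :=
  (hχ.comp (contDiff_const_smul _)).mul (contDiff_bracketWeight b)

lemma hasCompactSupport_truncatedWeight {χ : EuclideanSpace ℝ (Fin n) → ℝ}
    (hχ : HasCompactSupport χ) (b : ℝ) (k : ℕ) : HasCompactSupport (truncatedWeight χ b k) := by
  have h : ((k : ℝ) + 1)⁻¹ ≠ 0 := by positivity
  exact HasCompactSupport.mul_right (hχ.comp_homeomorph (Homeomorph.smulOfNeZero _ h))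

/-- In the nonlocal case the decay estimate applies with a derivative bound independent of the
truncation; at integer order locality gives the bound with no upper restriction on `b`. -/
lemma exists_abs_fracLaplacian_truncatedWeight_le (hn : n ≠ 0)
    {χ : EuclideanSpace ℝ (Fin n) → ℝ} (hχ : ContDiff ℝ ∞ χ) (hχc : HasCompactSupport χ)
    {ρ b : ℝ} (hρ : 0 < ρ) (hb : (n : ℝ) < b) (h : b ≤ n + 2 * ρ ∨ ∃ k : ℕ, ρ = k) :
    ∃ C, 0 ≤ C ∧ ∀ k x, |fracLaplacian ρ (truncatedWeight χ b k) x| ≤ C * bracketWeight b x := by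
  rcases h with h | ⟨l, rfl⟩
  · obtain ⟨m, hm⟩ := exists_nat_gt ρ
    obtain ⟨B, hB0, hB⟩ := exists_norm_iteratedFDeriv_truncation_le hχ hχc b (2 * m)
    obtain ⟨C, hC0, hC⟩ := exists_abs_fracLaplacian_le hn hρ hb h hm
    refine ⟨C * B, by positivity, fun k x => hC _ (contDiff_truncatedWeight hχ b k)
      (hasCompactSupport_truncatedWeight hχc b k) B hB0 (fun y => ?_) (fun y => ?_) x⟩
    · have := hB k 0 (Nat.zero_le _) y
      rwa [norm_iteratedFDeriv_zero, Real.norm_eq_abs] at this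
    · exact hB k _ le_rfl y
  · obtain ⟨B, hB0, hB⟩ := exists_norm_iteratedFDeriv_truncation_le hχ hχc b (2 * l)
    refine ⟨n ^ l * B, by positivity, fun k x => ?_⟩
    refine (abs_fracLaplacian_natCast_le (contDiff_truncatedWeight hχ b k)
      (hasCompactSupport_truncatedWeight hχc b k) l x).trans ?_
    rw [mul_assoc]
    gcongr
    exact hB k _ le_rfl x

/-- The polynomial weight is an admissible profile when its decay does not exceed that of the
nonlocal operators involved. -/
lemma exists_isAdmissibleProfile_bracketWeight (hn : n ≠ 0) {σ δ p b : ℝ} (hσ : 0 < σ)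
    (hδ : 0 < δ) (hp : 1 < p) (hb : (n : ℝ) < b)
    (h1 : b ≤ n + 2 * σ ∨ ∃ k : ℕ, σ = k) (h2 : b ≤ n + 2 * (2 * δ) ∨ ∃ k : ℕ, 2 * δ = k)
    (h3 : b ≤ n + 2 * δ ∨ ∃ k : ℕ, δ = k) :
    ∃ f C, IsAdmissibleProfile (n := n) σ δ p (bracketWeight b)
      (fun x => bracketWeight b x ^ ((p - 1) / p)) f C := by
  obtain ⟨χ, hχ, hχc, hχ0, hχ1, hχz, -, -⟩ :=
    exists_cutoff (E := EuclideanSpace ℝ (Fin n)) 0 hp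
  obtain ⟨C1, hC1, H1⟩ := exists_abs_fracLaplacian_truncatedWeight_le hn hχ hχc hσ hb h1
  obtain ⟨C2, hC2, H2⟩ := exists_abs_fracLaplacian_truncatedWeight_le hn hχ hχc
    (by linarith : 0 < 2 * δ) hb h2
  obtain ⟨C3, hC3, H3⟩ := exists_abs_fracLaplacian_truncatedWeight_le hn hχ hχc hδ hb h3
  have hp0 : 0 < p := by linarith
  have hb0 : 0 ≤ b := (Nat.cast_nonneg _).trans hb.le
  have hw : ∀ x : EuclideanSpace ℝ (Fin n), 0 < bracketWeight b x := bracketWeight_pos b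
  -- The dual factor `h = φ^((p-1)/p)` is chosen so that `φ^(1/p) h = φ` and `h^(p') = φ`, which is
  -- integrable since `b > n`.
  have hprod : ∀ x : EuclideanSpace ℝ (Fin n),
      bracketWeight b x ^ (1 / p) * bracketWeight b x ^ ((p - 1) / p) = bracketWeight b x := by
    intro x
    rw [← Real.rpow_add (hw x), ← add_div, add_sub_cancel, div_self hp0.ne', Real.rpow_one]
  have hle : ∀ k x, truncatedWeight χ b k x ≤ bracketWeight b x := fun k x =>
    mul_le_of_le_one_left (hw x).le (hχ1 _)
  have hmono : ∀ {c : ℝ} (x : EuclideanSpace ℝ (Fin n)), c ≤ 1 + C1 + C2 + C3 →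
      c * bracketWeight b x ≤ (1 + C1 + C2 + C3) * bracketWeight b x := fun x hc =>
    mul_le_mul_of_nonneg_right hc (hw x).le
  refine ⟨truncatedWeight χ b, 1 + C1 + C2 + C3, by positivity, continuous_bracketWeight b,
    bracketWeight_zero b, bracketWeight_le_one hb0, fun x => Real.rpow_nonneg (hw x).le _, ?_,
    contDiff_truncatedWeight hχ b, hasCompactSupport_truncatedWeight hχc b,
    fun k x => mul_nonneg (hχ0 _) (hw x).le, hle, fun x => ?_, fun k x => ?_, fun k x => ?_,
    fun k x => ?_, fun k x => ?_⟩
  · have : (fun x : EuclideanSpace ℝ (Fin n) =>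
        (bracketWeight b x ^ ((p - 1) / p)) ^ (p / (p - 1))) = bracketWeight b := by
      ext x
      have hp1 : p - 1 ≠ 0 := by linarith
      rw [← Real.rpow_mul (hw x).le, div_mul_div_cancel₀ hp0.ne', div_self hp1, Real.rpow_one]
    rw [this]
    exact integrable_bracketWeight (by simpa using hb)
  · have h0 : Filter.Tendsto (fun k : ℕ => ((k : ℝ) + 1)⁻¹ • x) Filter.atTop
        (nhds ((0 : ℝ) • x)) := by
      have := tendsto_one_div_add_atTop_nhds_zero_nat (𝕜 := ℝ)
      simp only [one_div] at this
      exact this.smul_const x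
    have h4 := ((hχ.continuous.tendsto _).comp h0).mul_const (bracketWeight b x)
    rwa [zero_smul, hχz, one_mul] at h4
  · rw [hprod]
    exact (hle k x).trans (by simpa using hmono (c := 1) x (by linarith))
  · rw [hprod]
    exact (H1 k x).trans (hmono x (by linarith))
  · rw [hprod]
    exact (H2 k x).trans (hmono x (by linarith))
  · rw [hprod]
    exact (H3 k x).trans (hmono x (by linarith))

/-- Nonexistence from integrability against the weight. -/
lemma IsGlobalWeakSolution.integral_nonpos_of_bracketWeight {σ δ p b : ℝ}
    {u₁ : EuclideanSpace ℝ (Fin n) → ℝ}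
    {u : ℝ × EuclideanSpace ℝ (Fin n) → ℝ} (hu : IsGlobalWeakSolution σ δ p u₁ u)
    (hδ : 0 < δ) (hδσ : δ < σ / 2) (hn : 2 * δ < n) (hu₁ : Integrable u₁) (hp : 1 < p)
    (hp_lt : p < 1 + 4 * δ / (n - 2 * δ)) (hb : (n : ℝ) < b)
    (h1 : b ≤ n + 2 * σ ∨ ∃ k : ℕ, σ = k) (h2 : b ≤ n + 2 * (2 * δ) ∨ ∃ k : ℕ, 2 * δ = k)
    (h3 : b ≤ n + 2 * δ ∨ ∃ k : ℕ, δ = k)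
    (hint : ∀ T, IntegrableOn (fun z => |u z| * bracketWeight b z.2) (Icc 0 T ×ˢ univ)) :
    ∫ x, u₁ x ≤ 0 := by
  have hn0 : n ≠ 0 := by
    rintro rfl
    simp only [Nat.cast_zero] at hn
    linarith
  have hb0 : 0 ≤ b := (Nat.cast_nonneg _).trans hb.le
  have hp0 : 0 < p := by linarith
  obtain ⟨f, C, hφ⟩ := exists_isAdmissibleProfile_bracketWeight hn0 (by linarith) hδ hp hb h1 h2 h3
  refine hu.integral_nonpos hδ hδσ hn hu₁ hp hp_lt hφ fun a ha0 ha1 T => ?_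
  have hw : ∀ x : EuclideanSpace ℝ (Fin n), 0 < bracketWeight b x := bracketWeight_pos b
  have hprod : ∀ x : EuclideanSpace ℝ (Fin n),
      bracketWeight b x ^ (1 / p) * bracketWeight b x ^ ((p - 1) / p) = bracketWeight b x := by
    intro x
    rw [← Real.rpow_add (hw x), ← add_div, add_sub_cancel, div_self hp0.ne', Real.rpow_one]
  simp_rw [hprod]
  have hm : MeasurableSet (Icc (0 : ℝ) T ×ˢ (univ : Set (EuclideanSpace ℝ (Fin n)))) :=
    measurableSet_Icc.prod MeasurableSet.univ
  have hsub : Icc (0 : ℝ) T ×ˢ (univ : Set (EuclideanSpace ℝ (Fin n))) ⊆ spaceTime n :=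
    fun z hz => ⟨hz.1.1, mem_univ _⟩
  refine ((hint T).const_mul (a⁻¹ ^ b)).mono' ?_ (Filter.Eventually.of_forall fun z => ?_)
  · refine ((hu.memLpLoc.aestronglyMeasurable hp).mono_measure
      (Measure.restrict_mono hsub le_rfl)).norm.mul ?_
    exact ((continuous_bracketWeight b).comp (by fun_prop)).aestronglyMeasurable
  · have := bracketWeight_comp_smul_le hb0 (one_le_inv₀ ha0 |>.2 ha1) z.2
    rw [inv_inv] at this
    rw [norm_mul, Real.norm_eq_abs, Real.norm_eq_abs, abs_abs, abs_of_pos (hw _)]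
    calc _ ≤ |u z| * (a⁻¹ ^ b * bracketWeight b z.2) := by gcongr
      _ = _ := by ring

/-- A compactly supported profile is admissible when all operators are local. -/
lemma exists_isAdmissibleProfile_natCast {σ δ p : ℝ} (hp : 1 < p) {k₁ k₂ k₃ : ℕ} (h1 : σ = k₁)
    (h2 : 2 * δ = k₂) (h3 : δ = k₃) :
    ∃ φ f C, IsAdmissibleProfile (n := n) σ δ p φ ((Metric.closedBall 0 2).indicator 1) f C := by
  -- The order `2 (k₁ + k₂ + k₃)` covers the derivatives of all three operators at once.
  obtain ⟨φ, hφ, hφc, hφ0, hφ1, hφz, hφ2, B, hB0, hB⟩ :=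
    exists_cutoff (E := EuclideanSpace ℝ (Fin n)) (2 * (k₁ + k₂ + k₃)) hp
  have hp0 : 0 < p := by linarith
  have hp1 : p - 1 ≠ 0 := by linarith
  have hprod : ∀ x, φ x ^ (1 / p) * (Metric.closedBall 0 2).indicator 1 x = φ x ^ (1 / p) := by
    intro x
    by_cases hx : x ∈ Metric.closedBall (0 : EuclideanSpace ℝ (Fin n)) 2
    · simp [indicator_of_mem hx]
    · have hx2 : 2 ≤ ‖x‖ := by
        simp only [Metric.mem_closedBall, dist_zero_right, not_le] at hx
        exact hx.le
      rw [hφ2 x hx2, Real.zero_rpow (by positivity), zero_mul]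
  have hr : ∀ x, 0 ≤ φ x ^ (1 / p) := fun x => Real.rpow_nonneg (hφ0 x) _
  have hloc : ∀ l ≤ k₁ + k₂ + k₃, ∀ x, |fracLaplacian (l : ℝ) φ x| ≤
      ((n : ℝ) + 1) ^ (k₁ + k₂ + k₃) * B * φ x ^ (1 / p) := by
    intro l hl x
    refine (abs_fracLaplacian_natCast_le hφ hφc l x).trans ?_
    rw [mul_assoc]
    refine mul_le_mul ?_ (hB _ (by omega) x) (norm_nonneg _) (by positivity)
    calc (n : ℝ) ^ l ≤ ((n : ℝ) + 1) ^ l := by gcongr; linarith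
      _ ≤ _ := pow_le_pow_right₀ (by linarith [n.cast_nonneg (α := ℝ)]) hl
  refine ⟨φ, fun _ => φ, ((n : ℝ) + 1) ^ (k₁ + k₂ + k₃) * B, by positivity, hφ.continuous, hφz,
    hφ1, fun x => indicator_nonneg (fun _ _ => zero_le_one) x, ?_, fun _ => hφ, fun _ => hφc,
    fun _ => hφ0, fun _ _ => le_rfl, fun _ => tendsto_const_nhds, fun k x => ?_, fun k x => ?_,
    fun k x => ?_, fun k x => ?_⟩
  · have : (fun x : EuclideanSpace ℝ (Fin n) =>
        ((Metric.closedBall 0 2).indicator 1 x : ℝ) ^ (p / (p - 1))) =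
        (Metric.closedBall 0 2).indicator 1 := by
      ext x
      by_cases hx : x ∈ Metric.closedBall (0 : EuclideanSpace ℝ (Fin n)) 2
      · simp [indicator_of_mem hx]
      · simp [indicator_of_notMem hx, Real.zero_rpow (div_ne_zero hp0.ne' hp1)]
    rw [this, integrable_indicator_iff measurableSet_closedBall]
    exact integrableOn_const (isCompact_closedBall _ _).measure_ne_top
  · rw [hprod]
    have h0 := hB 0 (Nat.zero_le _) x
    rw [norm_iteratedFDeriv_zero, Real.norm_eq_abs] at h0
    refine (le_abs_self _).trans (h0.trans ?_)
    refine mul_le_mul_of_nonneg_right ?_ (hr x)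
    exact le_mul_of_one_le_left hB0 (one_le_pow₀ (by linarith [n.cast_nonneg (α := ℝ)]))
  · rw [hprod, h1]
    exact hloc _ (by omega) x
  · rw [hprod, h2]
    exact hloc _ (by omega) x
  · rw [hprod, h3]
    exact hloc _ (by omega) x

/-- Here the profile is supported in a ball, so `u ∈ L^p_loc` already gives the integrability that
the nonlocal cases had to extract from the definition. -/
lemma IsGlobalWeakSolution.integral_nonpos_of_natCast {σ δ p : ℝ}
    {u₁ : EuclideanSpace ℝ (Fin n) → ℝ}
    {u : ℝ × EuclideanSpace ℝ (Fin n) → ℝ} (hu : IsGlobalWeakSolution σ δ p u₁ u)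
    (hδ : 0 < δ) (hδσ : δ < σ / 2) (hn : 2 * δ < n) (hu₁ : Integrable u₁) (hp : 1 < p)
    (hp_lt : p < 1 + 4 * δ / (n - 2 * δ)) {k₁ k₂ k₃ : ℕ} (h1 : σ = k₁)
    (h2 : 2 * δ = k₂) (h3 : δ = k₃) :
    ∫ x, u₁ x ≤ 0 := by
  obtain ⟨φ, f, C, hφ⟩ := exists_isAdmissibleProfile_natCast (n := n) hp h1 h2 h3
  refine hu.integral_nonpos hδ hδσ hn hu₁ hp hp_lt hφ fun a ha0 ha1 T => ?_
  have hφ0 : ∀ x, 0 ≤ φ x := fun x => ge_of_tendsto' (hφ.tendsto x) fun k => hφ.nonneg k x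
  have hp0 : 0 ≤ 1 / p := by positivity
  have hK : IntegrableOn u (Icc 0 T ×ˢ Metric.closedBall 0 (2 / a)) :=
    hu.memLpLoc.integrableOn hp (isCompact_Icc.prod (isCompact_closedBall _ _))
      fun z hz => ⟨hz.1.1, mem_univ _⟩
  have hm : MeasurableSet ((Metric.closedBall (0 : EuclideanSpace ℝ (Fin n)) 2)) :=
    measurableSet_closedBall
  have h4 : IntegrableOn (fun z => |u z| * (φ (a • z.2) ^ (1 / p) *
      (Metric.closedBall 0 2).indicator 1 (a • z.2))) (Icc 0 T ×ˢ Metric.closedBall 0 (2 / a)) := by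
    refine hK.abs.mul_bdd (c := 1) ?_ (Filter.Eventually.of_forall fun z => ?_)
    · refine AEStronglyMeasurable.mul ?_ ?_
      · exact ((hφ.continuous_profile.comp (by fun_prop)).rpow_const
          fun _ => Or.inr hp0).aestronglyMeasurable
      · exact ((measurable_one.indicator hm).comp
          (by fun_prop : Measurable fun z : ℝ × EuclideanSpace ℝ (Fin n) =>
            a • z.2)).aestronglyMeasurable
    · rw [norm_mul]
      refine mul_le_one₀ ?_ (norm_nonneg _) ?_
      · rw [Real.norm_eq_abs, abs_of_nonneg (Real.rpow_nonneg (hφ0 _) _)]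
        exact Real.rpow_le_one (hφ0 _) (hφ.profile_le_one _) hp0
      · refine (norm_indicator_le_norm_self _ _).trans ?_
        simp
  refine h4.of_forall_sdiff_eq_zero (measurableSet_Icc.prod MeasurableSet.univ) fun z hz => ?_
  have hz2 : a • z.2 ∉ Metric.closedBall (0 : EuclideanSpace ℝ (Fin n)) 2 := by
    intro hmem
    refine hz.2 ⟨hz.1.1, ?_⟩
    rw [Metric.mem_closedBall, dist_zero_right] at hmem ⊢
    rw [norm_smul, Real.norm_eq_abs, abs_of_pos ha0] at hmem
    rw [le_div_iff₀ ha0]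
    linarith
  rw [indicator_of_notMem hz2]
  ring

end Profiles

end

/-! ### Case distinction on the integrality of the orders. -/

theorem theorem2p2 (n : ℕ) (σ δ p : ℝ) (hσ : 1 ≤ σ) (hδ : 0 < δ) (hδσ : δ < σ / 2)
    (hn : 2 * δ < n) (u₁ : EuclideanSpace ℝ (Fin n) → ℝ) (hu₁ : Integrable u₁ volume)
    (hu₁_pos : 0 < ∫ x, u₁ x) (hp : 1 < p) (hp_lt : p < 1 + 4 * δ / (n - 2 * δ)) :
    ¬ ∃ u : ℝ × EuclideanSpace ℝ (Fin n) → ℝ, IsGlobalWeakSolution σ δ p u₁ u := by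
  rintro ⟨u, hu⟩
  have hn0 : n ≠ 0 := by
    rintro rfl
    simp only [Nat.cast_zero] at hn
    linarith
  refine hu₁_pos.not_ge ?_
  -- The decay `b` is dictated by the nonlocal operators present. If `δ` is not an integer, `n + 2δ`
  -- is the smallest of the three thresholds; if it is, `2δ` is one too and only `σ` can impose a
  -- restriction.
  by_cases hδi : ∃ k : ℕ, δ = k
  · obtain ⟨k, hk⟩ := hδi
    have h2k : 2 * δ = ((2 * k : ℕ) : ℝ) := by push_cast; rw [hk]
    by_cases hσi : ∃ l : ℕ, σ = l
    · obtain ⟨l, hl⟩ := hσi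
      exact hu.integral_nonpos_of_natCast hδ hδσ hn hu₁ hp hp_lt hl h2k hk
    · push Not at hσi
      exact hu.integral_nonpos_of_bracketWeight (b := n + 2 * σ) hδ hδσ hn hu₁ hp hp_lt
        (by linarith) (Or.inl le_rfl) (Or.inr ⟨_, h2k⟩) (Or.inr ⟨_, hk⟩)
        (hu.integrableOn_of_sigma hn0 hp (by linarith) hσi)
  · push Not at hδi
    exact hu.integral_nonpos_of_bracketWeight (b := n + 2 * δ) hδ hδσ hn hu₁ hp hp_lt
      (by linarith) (Or.inl (by linarith)) (Or.inl (by linarith)) (Or.inl le_rfl)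
      (hu.integrableOn_of_delta hn0 hp hδ hδi)
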